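/- Let $d$ be the dimension of velocity space, and for $T>0$ let $$M_T(v)=(2\pi T)^{-d/2}e^{-|v|^2/(2T)},\qquad v\in\mathbb R^d .$$ Let $0<T_1<T_2$, $\eta_1,\eta_2>0$, and put $\eta=\eta_1+\eta_2$, $T_\infty=(\eta_1T_1+\eta_2T_2)/\eta$. Let $$G_T[g]=T\Delta g+\operatorname{div}(v\,g),\qquad L_jg(v)=\eta_j\Big(M_{T_j}(v)\int_{\mathbb R^d}g(u)\,du-g(v)\Big),\quad j=1,2 .$$ Then the equation $\partial_tg=G_{T_\infty}[g]+L_1g+L_2g$ has a unique steady state $g_\infty$ with $\int g_\infty\,dv=1$, namely the mixture of Gaussians $$g_\infty(v)=\int_{[T_1,T_2]}w(T)\,M_T(v)\,dT,$$ where $w$ is the probability density on $[T_1,T_2]$ given by $$w(T)=\begin{cases}\dfrac{\eta_1}{2(T_\infty-T_1)^{\eta/2}}\,(T_\infty-T)^{\eta/2-1},&T\in[T_1,T_\infty),\\[2ex]\dfrac{\eta_2}{2(T_2-T_\infty)^{\eta/2}}\,(T-T_\infty)^{\eta/2-1},&T\in(T_\infty,T_2].\end{cases}$$ More precisely, $g_\infty$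 is a $C^\infty$ probability density that solves $G_{T_\infty}[g]+L_1g+L_2g=0$ pointwise, and also weakly, that is, $$\int g\,(T_\infty\Delta\varphi-v\cdot\nabla\varphi)\,dv+\sum_{j=1}^2\int (L_jg)\,\varphi\,dv=0\quad\text{for all }\varphi\in C_c^\infty(\mathbb R^d).$$ It is the only integrable $C^2$ function with integral $1$ that solves the stationary equation pointwise, and, up to equality almost everywhere, the only integrable function with integral $1$ that solves it weakly. -/

import Mathlib

open MeasureTheory
open scoped ContDiff

noncomputable section

namespace Thermostat

/-- The velocity space `ℝ^d` with its Euclidean norm and Lebesgue measure. -/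
abbrev Vel (d : ℕ) : Type := EuclideanSpace ℝ (Fin d)

/-- The Maxwellian velocity density `M_T(v) = (2πT)^{-d/2} exp(-|v|²/(2T))` on `ℝ^d`. -/
def maxwellian (d : ℕ) (T : ℝ) (v : Vel d) : ℝ :=
  (2 * Real.pi * T) ^ (-(d : ℝ) / 2) * Real.exp (-‖v‖ ^ 2 / (2 * T))

/-- The divergence `∑ i, ∂_i F_i` of a vector field on `ℝ^d`. -/
def divergence {d : ℕ} (F : Vel d → Vel d) (v : Vel d) : ℝ :=
  ∑ i : Fin d, (fderiv ℝ F v (EuclideanSpace.single i 1)) i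

/-- The Fokker-Planck operator `G_T[g] = T Δg + div(v g)`. -/
def fokkerPlanck {d : ℕ} (T : ℝ) (g : Vel d → ℝ) (v : Vel d) : ℝ :=
  T * Laplacian.laplacian g v + divergence (fun u => g u • u) v

/-- The reservoir operator `L g = r (ρ_g M_T - g)`, with rate `r`, temperature `T`, and
`ρ_g = ∫ g`. -/
def reservoir {d : ℕ} (r T : ℝ) (g : Vel d → ℝ) (v : Vel d) : ℝ :=
  r * ((∫ u, g u) * maxwellian d T v - g v)

/-- The total rate `∑ j, η_j`. -/
def totalRate {k : ℕ} (η : Fin k → ℝ) : ℝ := ∑ j, η j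

/-- The limiting temperature `T_∞ = (∑ j, η_j T_j) / (∑ j, η_j)`. -/
def limitTemp {k : ℕ} (η T : Fin k → ℝ) : ℝ := (∑ j, η j * T j) / totalRate η

/-- Classical solutions `g(v,t) = f t v`, `t > 0`, of `∂_t g = G_{T_∞} g + ∑ j, L_j g`:
integrable and `C²` in `v`, satisfying the equation pointwise. -/
def IsClassicalSolution {d k : ℕ} (η T : Fin k → ℝ) (f : ℝ → Vel d → ℝ) : Prop :=
  ∀ t : ℝ, 0 < t →
    Integrable (f t) ∧ ContDiff ℝ 2 (f t) ∧
    ∀ v : Vel d, HasDerivAt (fun s => f s v)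
      (fokkerPlanck (limitTemp η T) (f t) v + ∑ j, reservoir (η j) (T j) (f t) v) t

/-- Weak solutions `g(v,t) = f t v`, `t > 0`, of `∂_t g = G_{T_∞} g + ∑ j, L_j g`, tested against
`φ ∈ C_c^∞(ℝ^d)`. Here `fderiv ℝ φ v v` is `v · ∇φ(v)`, so `T_∞ Δφ - v · ∇φ` is the formal
adjoint of `G_{T_∞}` applied to `φ`. -/
def IsWeakSolution {d k : ℕ} (η T : Fin k → ℝ) (f : ℝ → Vel d → ℝ) : Prop :=
  ∀ t : ℝ, 0 < t →
    Integrable (f t) ∧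
    ∀ φ : Vel d → ℝ, ContDiff ℝ ∞ φ → HasCompactSupport φ →
      HasDerivAt (fun s => ∫ v, f s v * φ v)
        ((∫ v, f t v * (limitTemp η T * Laplacian.laplacian φ v - fderiv ℝ φ v v)) +
          ∑ j, ∫ v, reservoir (η j) (T j) (f t) v * φ v) t

/-- A classical steady state: a time-independent classical solution. -/
def IsClassicalSteadyState {d k : ℕ} (η T : Fin k → ℝ) (g : Vel d → ℝ) : Prop :=
  IsClassicalSolution η T (fun _ => g)

/-- A weak steady state: a time-independent weak solution. -/
def IsWeakSteadyState {d k : ℕ} (η T : Fin k → ℝ) (g : Vel d → ℝ) : Prop :=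
  IsWeakSolution η T (fun _ => g)

/-- The weight `w` for two reservoirs; index `0` is the cooler one (`T_1`, `η_1` in usual notation)
and index `1` the hotter one (`T_2`, `η_2`). It is set to `0` at `T_∞` and off `[T_1, T_2]`. -/
def weight (η T : Fin 2 → ℝ) (s : ℝ) : ℝ :=
  if T 0 ≤ s ∧ s < limitTemp η T then
    η 0 / (2 * (limitTemp η T - T 0) ^ (totalRate η / 2)) *
      (limitTemp η T - s) ^ (totalRate η / 2 - 1)
  else if limitTemp η T < s ∧ s ≤ T 1 then
    η 1 / (2 * (T 1 - limitTemp η T) ^ (totalRate η / 2)) *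
      (s - limitTemp η T) ^ (totalRate η / 2 - 1)
  else 0

/-- The mixture of Gaussians `g_∞(v) = ∫_{[T_1,T_2]} w(s) M_s(v) ds`. -/
def mixture (d : ℕ) (η T : Fin 2 → ℝ) (v : Vel d) : ℝ :=
  ∫ s in Set.Icc (T 0) (T 1), weight η T s * maxwellian d s v

end Thermostat

end

/-! Existence rests on the heat equation `∂_s M_s = (1/2) Δ M_s`, which gives `G_{T_∞}[M_s] = 2 (T_∞
- s) ∂_s M_s`. Hence `G_{T_∞}` applied to the mixture is `∫ 2 (T_∞ - s) w(s) ∂_s M_s ds`. The weight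
is chosen so that its flux `2 (T_∞ - s) w(s)` has derivative `-η w` and takes the values `η_1` and
`-η_2` at the two endpoints. Integrating by parts in `s` (`integral_weight_mul_deriv`) therefore
produces `η g_∞ - η_1 M_{T_1} - η_2 M_{T_2}`, which the reservoirs cancel (`fokkerPlanck_mixture`).
The same identity tested on the constant `1` shows that `w` has mass `1`.

For uniqueness, the difference `h` of two weak steady states of equal mass satisfies `T_∞ Δh + div(v
h) = η h` weakly, because the gain terms cancel (`isWeakKernel_sub`). A cut-off argument allows
Gaussian test functions (`IsWeakKernel.integral_gaussian`). The Ornstein-Uhlenbeck flow keeps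
Gaussians Gaussian, and along it the pairing with `h` is multiplied by `e^{ηt}`; but it is bounded,
since `h` is integrable, so it is zero (`integral_mul_exp_eq_zero`). Gaussians of all centres and
widths approximate every test function, so `h = 0` almost everywhere. Classical steady states are
weak ones, and continuity upgrades almost-everywhere equality to equality. -/

noncomputable section

namespace Thermostat

open Laplacian InnerProductSpace

/-! ### Differential calculus of `G_T` and of radial functions -/

/-- The Laplacian on `ℝ^d` is the sum of the second partial derivatives. -/
theorem laplacian_eq_sum_fderiv {d : ℕ} {f : Vel d → ℝ} (hf : ContDiff ℝ 2 f) (v : Vel d) :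
    laplacian f v = ∑ i : Fin d, fderiv ℝ (fun x => fderiv ℝ f x (EuclideanSpace.single i 1)) v
      (EuclideanSpace.single i 1) := by
  rw [laplacian_eq_iteratedFDeriv_orthonormalBasis f (EuclideanSpace.basisFun (Fin d) ℝ)]
  refine Finset.sum_congr rfl fun i _ => ?_
  have h1 : DifferentiableAt ℝ (fderiv ℝ f) v :=
    (hf.fderiv_right (m := 1) (by norm_num)).differentiable one_ne_zero v
  rw [iteratedFDeriv_two_apply, fderiv_clm_apply h1 (by fun_prop)]
  simp

theorem sum_fderiv_single_mul {d : ℕ} (L : Vel d →L[ℝ] ℝ) (v : Vel d) :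
    ∑ i : Fin d, L (EuclideanSpace.single i 1) * v i = L v := by
  conv_rhs => rw [← (EuclideanSpace.basisFun (Fin d) ℝ).sum_repr v, map_sum]
  simp [mul_comm]

theorem divergence_smul_id_eq_sum {d : ℕ} {g : Vel d → ℝ} (hg : Differentiable ℝ g) (v : Vel d) :
    divergence (fun u => g u • u) v =
      ∑ i : Fin d, fderiv ℝ (fun u => g u * u i) v (EuclideanSpace.single i 1) := by
  refine Finset.sum_congr rfl fun i _ => ?_
  have h2 : HasFDerivAt (fun u : Vel d => g u * u i)
      ((EuclideanSpace.proj i : Vel d →L[ℝ] ℝ).comp (fderiv ℝ (fun u => g u • u) v)) v := by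
    have h1 : DifferentiableAt ℝ (fun u => g u • u) v := by fun_prop
    exact (EuclideanSpace.proj i : Vel d →L[ℝ] ℝ).hasFDerivAt.comp v h1.hasFDerivAt
  rw [h2.fderiv]
  rfl

theorem divergence_smul_id {d : ℕ} {g : Vel d → ℝ} (hg : Differentiable ℝ g) (v : Vel d) :
    divergence (fun u => g u • u) v = d * g v + fderiv ℝ g v v := by
  have h1 (i : Fin d) : (fderiv ℝ (fun u => g u • u) v (EuclideanSpace.single i 1)) i =
      g v + fderiv ℝ g v (EuclideanSpace.single i 1) * v i := by
    rw [fderiv_fun_smul (hg v) (by fun_prop)]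
    simp
  simp only [divergence, h1, Finset.sum_add_distrib, sum_fderiv_single_mul]
  simp

/-- Profiles are taken in the squared distance, which is smooth at the centre too. The mixture needs
only the centre `0`, while the test Gaussians for uniqueness need every centre. -/
theorem hasFDerivAt_radial {d : ℕ} {F : ℝ → ℝ} {F' : ℝ} (c v : Vel d)
    (hF : HasDerivAt F F' (‖v - c‖ ^ 2)) :
    HasFDerivAt (fun u => F (‖u - c‖ ^ 2)) ((2 * F') • innerSL ℝ (v - c)) v := by
  have hid : HasFDerivAt (fun u : Vel d => u) (.id ℝ (Vel d)) v := hasFDerivAt_id v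
  refine (hF.comp_hasFDerivAt v (hid.sub_const c).norm_sq).congr_fderiv ?_
  ext w
  simp
  ring

theorem contDiff_radial {d : ℕ} {F : ℝ → ℝ} {n : WithTop ℕ∞} (hF : ContDiff ℝ n F) (c : Vel d) :
    ContDiff ℝ n (fun u : Vel d => F (‖u - c‖ ^ 2)) :=
  hF.comp ((contDiff_id.sub contDiff_const).norm_sq ℝ)

theorem fderiv_radial_apply {d : ℕ} {F F' : ℝ → ℝ} (hF' : ∀ x, HasDerivAt F (F' x) x)
    (c v w : Vel d) :
    fderiv ℝ (fun u => F (‖u - c‖ ^ 2)) v w = 2 * F' (‖v - c‖ ^ 2) * inner ℝ (v - c) w := by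
  rw [(hasFDerivAt_radial c v (hF' _)).fderiv]
  rfl

theorem laplacian_radial {d : ℕ} {F F' F'' : ℝ → ℝ} (hF : ContDiff ℝ 2 F)
    (hF' : ∀ x, HasDerivAt F (F' x) x) (hF'' : ∀ x, HasDerivAt F' (F'' x) x) (c v : Vel d) :
    laplacian (fun u => F (‖u - c‖ ^ 2)) v =
      4 * ‖v - c‖ ^ 2 * F'' (‖v - c‖ ^ 2) + 2 * d * F' (‖v - c‖ ^ 2) := by
  rw [laplacian_eq_sum_fderiv (contDiff_radial hF c)]
  have h1 (i : Fin d) : fderiv ℝ (fun x => fderiv ℝ (fun u => F (‖u - c‖ ^ 2)) x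
      (EuclideanSpace.single i 1)) v (EuclideanSpace.single i 1) =
      4 * F'' (‖v - c‖ ^ 2) * (v - c) i ^ 2 + 2 * F' (‖v - c‖ ^ 2) := by
    simp only [fderiv_radial_apply hF']
    have h0 (x : Vel d) : inner ℝ (x - c) (EuclideanSpace.single i (1 : ℝ)) = x i - c i := by
      simp [EuclideanSpace.inner_single_right]
    have h2 : HasFDerivAt (fun x : Vel d => x i - c i)
        (EuclideanSpace.proj i : Vel d →L[ℝ] ℝ) v :=
      (EuclideanSpace.proj i : Vel d →L[ℝ] ℝ).hasFDerivAt.sub_const _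
    simp only [h0]
    have h3 := ((hasFDerivAt_radial c v (hF'' _)).const_mul 2).fun_mul h2
    rw [h3.fderiv]
    simp [EuclideanSpace.inner_single_right]
    ring
  simp only [h1, Finset.sum_add_distrib, ← Finset.mul_sum]
  rw [EuclideanSpace.norm_sq_eq]
  simp
  ring

/-! ### Integration by parts: classical steady states are weak -/

theorem contDiff_partial {d : ℕ} {f : Vel d → ℝ} (hf : ContDiff ℝ 2 f) (w : Vel d) :
    ContDiff ℝ 1 fun v => fderiv ℝ f v w :=
  (hf.fderiv_right (m := 1) (by norm_num)).clm_apply contDiff_const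

theorem integral_mul_fderiv_of_hasCompactSupport {d : ℕ} {f g : Vel d → ℝ} (hf : ContDiff ℝ 1 f)
    (hg : ContDiff ℝ 1 g) (hc : HasCompactSupport g) (w : Vel d) :
    ∫ v, f v * fderiv ℝ g v w = - ∫ v, fderiv ℝ f v w * g v := by
  have hf' : Continuous fun v => fderiv ℝ f v w :=
    (hf.continuous_fderiv one_ne_zero).clm_apply continuous_const
  have hg' : Continuous fun v => fderiv ℝ g v w :=
    (hg.continuous_fderiv one_ne_zero).clm_apply continuous_const
  have hc' : HasCompactSupport fun v => fderiv ℝ g v w := hc.fderiv_apply ℝ w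
  refine integral_mul_fderiv_eq_neg_fderiv_mul_of_integrable ?_ ?_ ?_ ?_ ?_
  · exact (hf'.mul hg.continuous).integrable_of_hasCompactSupport hc.mul_left
  · exact (hf.continuous.mul hg').integrable_of_hasCompactSupport hc'.mul_left
  · exact (hf.continuous.mul hg.continuous).integrable_of_hasCompactSupport hc.mul_left
  · exact fun v _ => hf.differentiable one_ne_zero v
  · exact fun v _ => hg.differentiable one_ne_zero v

theorem continuous_laplacian {d : ℕ} {f : Vel d → ℝ} (hf : ContDiff ℝ 2 f) :
    Continuous (laplacian f) := by
  have : laplacian f = fun v => ∑ i : Fin d,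
      fderiv ℝ (fun x => fderiv ℝ f x (EuclideanSpace.single i 1)) v (EuclideanSpace.single i 1) :=
    funext (laplacian_eq_sum_fderiv hf)
  rw [this]
  refine continuous_finsetSum _ fun i _ => ?_
  exact ((contDiff_partial hf _).continuous_fderiv one_ne_zero).clm_apply continuous_const

theorem integral_mul_laplacian {d : ℕ} {f g : Vel d → ℝ} (hf : ContDiff ℝ 2 f)
    (hg : ContDiff ℝ 2 g) (hc : HasCompactSupport g) :
    ∫ v, f v * laplacian g v = ∫ v, laplacian f v * g v := by
  have hf1 : ContDiff ℝ 1 f := hf.of_le (by norm_num)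
  have hg1 : ContDiff ℝ 1 g := hg.of_le (by norm_num)
  simp only [laplacian_eq_sum_fderiv hf, laplacian_eq_sum_fderiv hg, Finset.mul_sum,
    Finset.sum_mul]
  rw [integral_finsetSum, integral_finsetSum]
  · refine Finset.sum_congr rfl fun i _ => ?_
    rw [integral_mul_fderiv_of_hasCompactSupport hf1 (contDiff_partial hg _) (hc.fderiv_apply ℝ _),
      integral_mul_fderiv_of_hasCompactSupport (contDiff_partial hf _) hg1 hc, neg_neg]
  · intro i _
    exact ((((contDiff_partial hf _).continuous_fderiv one_ne_zero).clm_apply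
      continuous_const).mul hg.continuous).integrable_of_hasCompactSupport hc.mul_left
  · intro i _
    exact (hf.continuous.mul (((contDiff_partial hg _).continuous_fderiv one_ne_zero).clm_apply
      continuous_const)).integrable_of_hasCompactSupport
      ((hc.fderiv_apply ℝ _).fderiv_apply ℝ _).mul_left

theorem integral_mul_fderiv_self {d : ℕ} {f g : Vel d → ℝ} (hf : ContDiff ℝ 1 f)
    (hg : ContDiff ℝ 1 g) (hc : HasCompactSupport g) :
    ∫ v, f v * fderiv ℝ g v v = - ∫ v, divergence (fun u => f u • u) v * g v := by
  have hfi (i : Fin d) : ContDiff ℝ 1 fun v : Vel d => f v * v i := by fun_prop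
  have e : (fun v => f v * fderiv ℝ g v v) = fun v => ∑ i : Fin d,
      f v * (fderiv ℝ g v (EuclideanSpace.single i 1) * v i) :=
    funext fun v => by rw [← Finset.mul_sum, sum_fderiv_single_mul]
  simp only [e, divergence_smul_id_eq_sum (hf.differentiable one_ne_zero), Finset.sum_mul]
  rw [integral_finsetSum, integral_finsetSum, ← Finset.sum_neg_distrib]
  · refine Finset.sum_congr rfl fun i _ => ?_
    rw [← integral_mul_fderiv_of_hasCompactSupport (hfi i) hg hc]
    congr 1 with v
    ring
  · intro i _
    exact ((((hfi i).continuous_fderiv one_ne_zero).clm_apply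
      continuous_const).mul hg.continuous).integrable_of_hasCompactSupport hc.mul_left
  · intro i _
    have h := ((hfi i).continuous.mul ((hg.continuous_fderiv one_ne_zero).clm_apply
      continuous_const)).integrable_of_hasCompactSupport (μ := volume)
      (hc.fderiv_apply ℝ (EuclideanSpace.single i 1)).mul_left
    refine h.congr (.of_forall fun v => ?_)
    simp only [Pi.mul_apply]
    ring

theorem continuous_divergence {d : ℕ} {f : Vel d → ℝ} (hf : ContDiff ℝ 1 f) :
    Continuous (divergence fun u => f u • u) := by
  have : (divergence fun u => f u • u) = fun v => d * f v + fderiv ℝ f v v :=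
    funext (divergence_smul_id (hf.differentiable one_ne_zero))
  rw [this]
  exact (continuous_const.mul hf.continuous).add
    ((hf.continuous_fderiv one_ne_zero).clm_apply continuous_id)

theorem continuous_maxwellian (d : ℕ) (T : ℝ) : Continuous (maxwellian d T) := by
  unfold maxwellian; fun_prop

/-- Multiply the pointwise equation by `φ` and integrate by parts. The compact support of `φ`
removes all boundary terms, so no decay of the derivatives of `g` is needed. -/
theorem IsClassicalSteadyState.isWeakSteadyState {d k : ℕ} {η T : Fin k → ℝ} {g : Vel d → ℝ}
    (h : IsClassicalSteadyState η T g) : IsWeakSteadyState η T g := by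
  intro t ht
  obtain ⟨hi, hg, hd⟩ := h t ht
  refine ⟨hi, fun φ hφ hc => ?_⟩
  have hφ2 : ContDiff ℝ 2 φ := contDiff_infty.1 hφ 2
  have hφ1 : ContDiff ℝ 1 φ := contDiff_infty.1 hφ 1
  have hg1 : ContDiff ℝ 1 g := hg.of_le (by norm_num)
  -- A time-independent function has time derivative `0`, so uniqueness of derivatives gives the
  -- stationary equation.
  have heq (v : Vel d) : fokkerPlanck (limitTemp η T) g v + ∑ j, reservoir (η j) (T j) g v = 0 :=
    (hd v).unique (hasDerivAt_const t (g v))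
  have hres (j : Fin k) : Continuous (reservoir (η j) (T j) g) := by
    have := continuous_maxwellian d (T j)
    have := hg.continuous
    unfold reservoir; fun_prop
  have hresi (j : Fin k) : Integrable fun v => reservoir (η j) (T j) g v * φ v :=
    ((hres j).mul hφ.continuous).integrable_of_hasCompactSupport hc.mul_left
  have hL : Integrable fun v => laplacian g v * φ v :=
    ((continuous_laplacian hg).mul hφ.continuous).integrable_of_hasCompactSupport hc.mul_left
  have hD : Integrable fun v => divergence (fun u => g u • u) v * φ v :=
    ((continuous_divergence hg1).mul hφ.continuous).integrable_of_hasCompactSupport hc.mul_left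
  have hL' : Integrable fun v => g v * laplacian φ v := by
    refine (hg.continuous.mul (continuous_laplacian hφ2)).integrable_of_hasCompactSupport ?_
    refine hc.mono' fun v hv => ?_
    contrapose! hv
    have h0 : φ =ᶠ[nhds v] fun _ => 0 := notMem_tsupport_iff_eventuallyEq.1 hv
    simp [(laplacian_congr_nhds h0).eq_of_nhds]
  have hD' : Integrable fun v => g v * fderiv ℝ φ v v := by
    refine (hg.continuous.mul ((hφ1.continuous_fderiv one_ne_zero).clm_apply
      continuous_id)).integrable_of_hasCompactSupport ?_
    refine hc.mono' fun v hv => ?_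
    contrapose! hv
    simp [fderiv_of_notMem_tsupport ℝ hv]
  suffices hz : (∫ v, g v * (limitTemp η T * laplacian φ v - fderiv ℝ φ v v)) +
      ∑ j, ∫ v, reservoir (η j) (T j) g v * φ v = 0 by
    rw [hz]; exact hasDerivAt_const t _
  have e1 : ∫ v, g v * (limitTemp η T * laplacian φ v - fderiv ℝ φ v v) =
      limitTemp η T * (∫ v, laplacian g v * φ v) + ∫ v, divergence (fun u => g u • u) v * φ v := by
    rw [← integral_mul_laplacian hg hφ2 hc, ← neg_neg (∫ v, divergence _ v * φ v),
      ← integral_mul_fderiv_self hg1 hφ1 hc, ← integral_const_mul, ← sub_eq_add_neg,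
      ← integral_sub (hL'.const_mul _) hD']
    congr 1 with v
    ring
  have hLD : Integrable fun v => limitTemp η T * (laplacian g v * φ v) +
      divergence (fun u => g u • u) v * φ v := (hL.const_mul _).add hD
  rw [e1, ← integral_finsetSum _ fun j _ => hresi j, ← integral_const_mul,
    ← integral_add (hL.const_mul _) hD,
    ← integral_add hLD (integrable_finsetSum _ fun j _ => hresi j)]
  refine integral_eq_zero_of_ae (.of_forall fun v => ?_)
  simp only [← Finset.sum_mul, Pi.zero_apply]
  have := heq v
  simp only [fokkerPlanck] at this
  linear_combination φ v * this

/-! ### Maxwellians: mass and temperature derivative -/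

theorem maxwellian_nonneg (d : ℕ) {T : ℝ} (hT : 0 ≤ T) (v : Vel d) : 0 ≤ maxwellian d T v := by
  unfold maxwellian; positivity

theorem integral_maxwellian (d : ℕ) {T : ℝ} (hT : 0 < T) : ∫ v, maxwellian d T v = 1 := by
  have h := GaussianFourier.integral_rexp_neg_mul_sq_norm (V := Vel d) (b := (2 * T)⁻¹)
    (by positivity)
  simp only [finrank_euclideanSpace, Fintype.card_fin] at h
  have e (v : Vel d) : -(2 * T)⁻¹ * ‖v‖ ^ 2 = -‖v‖ ^ 2 / (2 * T) := by ring
  simp only [e] at h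
  simp only [maxwellian, integral_const_mul, h]
  rw [div_inv_eq_mul, show Real.pi * (2 * T) = 2 * Real.pi * T by ring,
    ← Real.rpow_add (by positivity), neg_div, neg_add_cancel, Real.rpow_zero]

theorem integrable_maxwellian (d : ℕ) {T : ℝ} (hT : 0 < T) : Integrable (maxwellian d T) :=
  .of_integral_ne_zero (by rw [integral_maxwellian d hT]; exact one_ne_zero)

/-- The derivative is `(1/2) Δ M_s` written out: temperature plays the role of time in the heat
equation. -/
theorem hasDerivAt_maxwellian (d : ℕ) {s : ℝ} (hs : 0 < s) (v : Vel d) :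
    HasDerivAt (fun T => maxwellian d T v)
      ((‖v‖ ^ 2 / (2 * s ^ 2) - d / (2 * s)) * maxwellian d s v) s := by
  have h1 : HasDerivAt (fun T : ℝ => (2 * Real.pi * T) ^ (-(d : ℝ) / 2))
      ((-(d : ℝ) / (2 * s)) * (2 * Real.pi * s) ^ (-(d : ℝ) / 2)) s := by
    have h := (((hasDerivAt_id s).const_mul (2 * Real.pi)).rpow_const (p := -(d : ℝ) / 2)
      (Or.inl (by simpa using hs.ne')))
    refine h.congr_deriv ?_
    simp only [id, mul_one]
    rw [Real.rpow_sub_one (by positivity)]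
    field_simp
  have h2 : HasDerivAt (fun T : ℝ => Real.exp (-‖v‖ ^ 2 / (2 * T)))
      (Real.exp (-‖v‖ ^ 2 / (2 * s)) * (‖v‖ ^ 2 / (2 * s ^ 2))) s := by
    have h := (((hasDerivAt_id s).const_mul 2).fun_inv (by simpa using hs.ne')).const_mul
      (-‖v‖ ^ 2)
    refine (h.exp).congr_deriv ?_ |>.congr_of_eventuallyEq ?_
    · simp only [id, div_eq_mul_inv]
      field_simp
    · exact .of_forall fun T => by simp [div_eq_mul_inv]
  refine (h1.mul h2).congr_deriv ?_
  unfold maxwellian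
  field_simp
  ring

/-! ### The weight, its flux, and integration by parts in temperature -/

section Weight

variable {η T : Fin 2 → ℝ}

theorem totalRate_pos (hη : ∀ j, 0 < η j) : 0 < totalRate η := by
  have h0 := hη 0
  have h1 := hη 1
  simp only [totalRate, Fin.sum_univ_two]
  positivity

theorem lt_limitTemp (hη : ∀ j, 0 < η j) (hT : T 0 < T 1) : T 0 < limitTemp η T := by
  rw [limitTemp, lt_div_iff₀ (totalRate_pos hη)]
  simp only [totalRate, Fin.sum_univ_two]
  nlinarith [hη 1]

theorem limitTemp_lt (hη : ∀ j, 0 < η j) (hT : T 0 < T 1) : limitTemp η T < T 1 := by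
  rw [limitTemp, div_lt_iff₀ (totalRate_pos hη)]
  simp only [totalRate, Fin.sum_univ_two]
  nlinarith [hη 0]

theorem weight_nonneg (hη : ∀ j, 0 < η j) (hT : T 0 < T 1) (s : ℝ) : 0 ≤ weight η T s := by
  have h0 := (hη 0).le
  have h1 := (hη 1).le
  have h2 := sub_nonneg.2 (lt_limitTemp hη hT).le
  have h3 := sub_nonneg.2 (limitTemp_lt hη hT).le
  unfold weight
  split_ifs with ha hb
  · have := sub_nonneg.2 ha.2.le
    positivity
  · have := sub_nonneg.2 hb.1.le
    positivity
  · exact le_rfl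

theorem measurable_weight (η T : Fin 2 → ℝ) : Measurable (weight η T) := by
  unfold weight
  refine Measurable.ite ?_ (by fun_prop) (Measurable.ite ?_ (by fun_prop) (by fun_prop))
  · exact measurableSet_Ico (a := T 0) (b := limitTemp η T)
  · exact measurableSet_Ioc (a := limitTemp η T) (b := T 1)

/-- The function `2 (T_∞ - s) w(s)` on `[T_1, T_2]`, whose derivative off `T_∞` is `-η w`. -/
def weightFlux (η T : Fin 2 → ℝ) (s : ℝ) : ℝ :=
  if s ≤ limitTemp η T then
    η 0 / (limitTemp η T - T 0) ^ (totalRate η / 2) * (limitTemp η T - s) ^ (totalRate η / 2)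
  else
    -(η 1 / (T 1 - limitTemp η T) ^ (totalRate η / 2) * (s - limitTemp η T) ^ (totalRate η / 2))

/-- Both branches vanish at `T_∞` because the exponent `η/2` is positive. The weight itself blows up
there when `η < 2`, which is why the argument runs through the flux. -/
theorem continuous_weightFlux (hη : ∀ j, 0 < η j) : Continuous (weightFlux η T) := by
  have hσ : 0 < totalRate η / 2 := half_pos (totalRate_pos hη)
  refine Continuous.if_le ?_ ?_ continuous_id continuous_const ?_
  · exact continuous_const.mul ((continuous_const.sub continuous_id).rpow_const
      fun _ => Or.inr hσ.le)
  · exact (continuous_const.mul ((continuous_id.sub continuous_const).rpow_const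
      fun _ => Or.inr hσ.le)).neg
  · rintro s rfl
    simp [Real.zero_rpow hσ.ne']

/-- The normalizing constants of `w` are fixed by the endpoint values of the flux, which become the
source terms of the reservoirs. -/
theorem weightFlux_left (hη : ∀ j, 0 < η j) (hT : T 0 < T 1) : weightFlux η T (T 0) = η 0 := by
  have h := lt_limitTemp hη hT
  have := (Real.rpow_pos_of_pos (sub_pos.2 h) (totalRate η / 2)).ne'
  rw [weightFlux, if_pos h.le]
  field_simp

theorem weightFlux_right (hη : ∀ j, 0 < η j) (hT : T 0 < T 1) : weightFlux η T (T 1) = -η 1 := by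
  have h := limitTemp_lt hη hT
  have := (Real.rpow_pos_of_pos (sub_pos.2 h) (totalRate η / 2)).ne'
  rw [weightFlux, if_neg h.not_ge]
  field_simp

theorem weightFlux_eq {s : ℝ} (hη : ∀ j, 0 < η j) (hs : s ∈ Set.Icc (T 0) (T 1)) :
    weightFlux η T s = 2 * (limitTemp η T - s) * weight η T s := by
  have hσ : 0 < totalRate η / 2 := half_pos (totalRate_pos hη)
  rcases lt_trichotomy s (limitTemp η T) with h | h | h
  · rw [weightFlux, weight, if_pos h.le, if_pos ⟨hs.1, h⟩, Real.rpow_sub_one (sub_pos.2 h).ne']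
    have := (sub_pos.2 h).ne'
    field_simp
  · simp [weightFlux, h, Real.zero_rpow hσ.ne']
  · rw [weightFlux, weight, if_neg h.not_ge, if_neg (fun h' => h'.2.not_gt h), if_pos ⟨h, hs.2⟩,
      Real.rpow_sub_one (sub_pos.2 h).ne']
    have := (sub_pos.2 h).ne'
    field_simp
    ring

theorem hasDerivAt_weightFlux {s : ℝ} (hs : s ∈ Set.Ioo (T 0) (T 1))
    (hne : s ≠ limitTemp η T) :
    HasDerivAt (weightFlux η T) (-totalRate η * weight η T s) s := by
  rcases lt_or_gt_of_ne hne with h | h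
  · have h1 := (((hasDerivAt_id s).const_sub (limitTemp η T)).rpow_const
      (p := totalRate η / 2) (Or.inl (sub_pos.2 h).ne')).const_mul
      (η 0 / (limitTemp η T - T 0) ^ (totalRate η / 2))
    refine (h1.congr_of_eventuallyEq ?_).congr_deriv ?_
    · filter_upwards [Iio_mem_nhds h] with x hx
      rw [weightFlux, if_pos (le_of_lt hx)]
      rfl
    · rw [weight, if_pos ⟨hs.1.le, h⟩]
      simp only [id]
      ring
  · have h1 := ((((hasDerivAt_id s).sub_const (limitTemp η T)).rpow_const
      (p := totalRate η / 2) (Or.inl (sub_pos.2 h).ne')).const_mul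
      (η 1 / (T 1 - limitTemp η T) ^ (totalRate η / 2))).fun_neg
    refine (h1.congr_of_eventuallyEq ?_).congr_deriv ?_
    · filter_upwards [Ioi_mem_nhds h] with x hx
      rw [weightFlux, if_neg (not_le_of_gt hx)]
      rfl
    · rw [weight, if_neg (fun h' => h'.2.not_gt h), if_pos ⟨h, hs.2.le⟩]
      simp only [id]
      ring

/-- On each side of `T_∞` the weight is the nonnegative derivative of the continuous function
`-weightFlux / η`, hence integrable despite a possible singularity. -/
theorem intervalIntegrable_weight (hη : ∀ j, 0 < η j) (hT : T 0 < T 1) :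
    IntervalIntegrable (weight η T) volume (T 0) (T 1) := by
  have hσ := totalRate_pos hη
  have h0 := lt_limitTemp hη hT
  have h1 := limitTemp_lt hη hT
  have hc : Continuous fun s => -(totalRate η)⁻¹ * weightFlux η T s :=
    continuous_const.mul (continuous_weightFlux hη)
  have hd (s : ℝ) (hs : s ∈ Set.Ioo (T 0) (T 1)) (hne : s ≠ limitTemp η T) :
      HasDerivAt (fun s => -(totalRate η)⁻¹ * weightFlux η T s) (weight η T s) s := by
    refine ((hasDerivAt_weightFlux hs hne).const_mul _).congr_deriv ?_
    field_simp
  have ha : IntervalIntegrable (weight η T) volume (T 0) (limitTemp η T) :=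
    (intervalIntegrable_iff_integrableOn_Ioc_of_le h0.le).2
      (intervalIntegral.integrableOn_deriv_of_nonneg hc.continuousOn
        (fun s hs => hd s ⟨hs.1, hs.2.trans h1⟩ hs.2.ne) fun s _ => weight_nonneg hη hT s)
  have hb : IntervalIntegrable (weight η T) volume (limitTemp η T) (T 1) :=
    (intervalIntegrable_iff_integrableOn_Ioc_of_le h1.le).2
      (intervalIntegral.integrableOn_deriv_of_nonneg hc.continuousOn
        (fun s hs => hd s ⟨h0.trans hs.1, hs.2⟩ hs.1.ne') fun s _ => weight_nonneg hη hT s)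
  exact ha.trans hb

theorem integrableOn_weight (hη : ∀ j, 0 < η j) (hT : T 0 < T 1) :
    IntegrableOn (weight η T) (Set.Icc (T 0) (T 1)) :=
  (intervalIntegrable_iff_integrableOn_Icc_of_le hT.le).1 (intervalIntegrable_weight hη hT)

theorem integrableOn_weight_mul (hη : ∀ j, 0 < η j) (hT : T 0 < T 1) {f : ℝ → ℝ}
    (hf : ContinuousOn f (Set.Icc (T 0) (T 1))) :
    IntegrableOn (fun s => weight η T s * f s) (Set.Icc (T 0) (T 1)) :=
  (integrableOn_weight hη hT).mul_continuousOn hf isCompact_Icc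

/-- Integration by parts against the weight. -/
theorem integral_weight_mul_deriv (hη : ∀ j, 0 < η j) (hT : T 0 < T 1) {f f' : ℝ → ℝ}
    (hf : ContinuousOn f (Set.Icc (T 0) (T 1))) (hf' : ContinuousOn f' (Set.Icc (T 0) (T 1)))
    (hd : ∀ s ∈ Set.Ioo (T 0) (T 1), HasDerivAt f (f' s) s) :
    ∫ s in Set.Icc (T 0) (T 1),
      (weight η T s * (2 * (limitTemp η T - s) * f' s) - weight η T s * (totalRate η * f s)) =
      -(η 0 * f (T 0) + η 1 * f (T 1)) := by
  have hi1 : IntegrableOn (fun s => weight η T s * (2 * (limitTemp η T - s) * f' s))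
      (Set.Icc (T 0) (T 1)) := integrableOn_weight_mul hη hT (by fun_prop)
  have hi2 : IntegrableOn (fun s => weight η T s * (totalRate η * f s))
      (Set.Icc (T 0) (T 1)) := integrableOn_weight_mul hη hT (by fun_prop)
  -- The flux may fail to be differentiable at `T_∞`. One exceptional point is harmless, since the
  -- product is continuous and the derivative is integrable.
  have h := integral_eq_of_hasDerivAt_off_countable_of_le (fun s => weightFlux η T s * f s)
    (fun s => weight η T s * (2 * (limitTemp η T - s) * f' s) -
      weight η T s * (totalRate η * f s)) hT.le (Set.countable_singleton (limitTemp η T))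
    ((continuous_weightFlux hη).continuousOn.mul hf) ?_
    ((intervalIntegrable_iff_integrableOn_Icc_of_le hT.le).2 (hi1.sub hi2))
  · rw [intervalIntegral.integral_of_le hT.le, ← integral_Icc_eq_integral_Ioc] at h
    rw [h, weightFlux_left hη hT, weightFlux_right hη hT]
    ring
  · rintro s ⟨hs, hne⟩
    refine ((hasDerivAt_weightFlux hs hne).fun_mul (hd s hs)).congr_deriv ?_
    rw [weightFlux_eq hη (Set.Ioo_subset_Icc_self hs)]
    ring

theorem integral_weight (hη : ∀ j, 0 < η j) (hT : T 0 < T 1) :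
    ∫ s in Set.Icc (T 0) (T 1), weight η T s = 1 := by
  have hσ := totalRate_pos hη
  -- Testing on `1` leaves `-η ∫ w = -(η_1 + η_2)`.
  have h := integral_weight_mul_deriv (f := fun _ => 1) (f' := fun _ => 0) hη hT
    continuousOn_const continuousOn_const fun s _ => hasDerivAt_const s 1
  simp only [mul_zero, zero_sub, mul_one, integral_neg, integral_mul_const] at h
  have e : totalRate η = η 0 + η 1 := Fin.sum_univ_two η
  rw [← e, neg_inj] at h
  exact mul_right_cancel₀ hσ.ne' (h.trans (one_mul _).symm)

end Weight

/-! ### The mixture: smoothness, mass and stationarity -/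

/-- The `n`-th derivative in `x` of the radial profile `∫ w(s) (2πs)^{-d/2} e^{-x/(2s)} ds` of the
mixture. -/
def mixtureProfile (d : ℕ) (η T : Fin 2 → ℝ) (n : ℕ) (x : ℝ) : ℝ :=
  ∫ s in Set.Icc (T 0) (T 1), weight η T s *
    ((2 * Real.pi * s) ^ (-(d : ℝ) / 2) * ((-(2 * s)⁻¹) ^ n * Real.exp (x * -(2 * s)⁻¹)))

/-- The measure whose Laplace transform is the radial profile of the mixture. -/
def mixtureMeasure (d : ℕ) (η T : Fin 2 → ℝ) : Measure ℝ :=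
  (volume.restrict (Set.Icc (T 0) (T 1))).withDensity fun s =>
    ENNReal.ofReal (weight η T s * (2 * Real.pi * s) ^ (-(d : ℝ) / 2))

theorem mixture_eq_mixtureProfile (d : ℕ) (η T : Fin 2 → ℝ) (v : Vel d) :
    mixture d η T v = mixtureProfile d η T 0 (‖v‖ ^ 2) := by
  unfold mixture mixtureProfile maxwellian
  congr 1 with s
  simp only [pow_zero, one_mul, mul_neg, div_eq_mul_inv, neg_mul]

section Profile

variable {d : ℕ} {η T : Fin 2 → ℝ}

theorem integral_mixtureMeasure (hη : ∀ j, 0 < η j) (hT₀ : 0 < T 0) (hT : T 0 < T 1)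
    (f : ℝ → ℝ) :
    ∫ s, f s ∂(mixtureMeasure d η T) = ∫ s in Set.Icc (T 0) (T 1),
      weight η T s * ((2 * Real.pi * s) ^ (-(d : ℝ) / 2) * f s) := by
  have hm := measurable_weight η T
  rw [mixtureMeasure, integral_withDensity_eq_integral_toReal_smul (by fun_prop)
    (.of_forall fun _ => ENNReal.ofReal_lt_top)]
  refine setIntegral_congr_fun measurableSet_Icc fun s hs => ?_
  have hs0 : 0 < s := hT₀.trans_le hs.1
  have := weight_nonneg hη hT s
  rw [ENNReal.toReal_ofReal (by positivity), smul_eq_mul, mul_assoc]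

theorem continuousOn_rpow_const_Icc (hT₀ : 0 < T 0) (p : ℝ) :
    ContinuousOn (fun s : ℝ => (2 * Real.pi * s) ^ p) (Set.Icc (T 0) (T 1)) :=
  ContinuousOn.rpow_const (by fun_prop) fun s hs => Or.inl (by
    have : 0 < s := hT₀.trans_le hs.1
    positivity)

theorem continuousOn_inv_Icc (hT₀ : 0 < T 0) :
    ContinuousOn (fun s : ℝ => (2 * s)⁻¹) (Set.Icc (T 0) (T 1)) :=
  ContinuousOn.inv₀ (by fun_prop) fun s hs => by
    have : 0 < s := hT₀.trans_le hs.1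
    positivity

/-- Since `s ≥ T_1 > 0`, the variable `-(2s)⁻¹` stays in `[-(2T_1)⁻¹, 0]`. A bounded variable under
a finite measure has all exponential moments, so its moment generating function, the radial profile,
is analytic everywhere and may be differentiated under the integral. -/
theorem interior_integrableExpSet_mixtureMeasure (hη : ∀ j, 0 < η j) (hT₀ : 0 < T 0)
    (hT : T 0 < T 1) :
    interior (ProbabilityTheory.integrableExpSet (fun s => -(2 * s)⁻¹) (mixtureMeasure d η T)) =
      Set.univ := by
  rw [interior_eq_univ]
  refine Set.eq_univ_of_forall fun t => ?_
  have hi := integrableOn_weight_mul hη hT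
    (continuousOn_rpow_const_Icc (T := T) hT₀ (-(d : ℝ) / 2))
  have : IsFiniteMeasure (mixtureMeasure d η T) := isFiniteMeasure_withDensity_ofReal hi.2
  have hX : Measurable fun s : ℝ => -(2 * s)⁻¹ := by fun_prop
  refine ProbabilityTheory.integrable_exp_mul_of_mem_Icc (a := -(2 * T 0)⁻¹) (b := 0)
    hX.aemeasurable ?_
  refine (withDensity_absolutelyContinuous _ _).ae_le ?_
  filter_upwards [ae_restrict_mem measurableSet_Icc] with s hs
  have hs0 : 0 < s := hT₀.trans_le hs.1
  constructor
  · have h1 := hs.1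
    gcongr
  · simp only [Left.neg_nonpos_iff]
    positivity

theorem hasDerivAt_mixtureProfile (hη : ∀ j, 0 < η j) (hT₀ : 0 < T 0) (hT : T 0 < T 1) (n : ℕ)
    (x : ℝ) : HasDerivAt (mixtureProfile d η T n) (mixtureProfile d η T (n + 1) x) x := by
  have h := ProbabilityTheory.hasDerivAt_integral_pow_mul_exp_real (μ := mixtureMeasure d η T)
    (X := fun s => -(2 * s)⁻¹) (t := x)
    (by rw [interior_integrableExpSet_mixtureMeasure hη hT₀ hT]; trivial) n
  simp only [integral_mixtureMeasure hη hT₀ hT] at h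
  exact h

theorem contDiff_mixtureProfile_zero (hη : ∀ j, 0 < η j) (hT₀ : 0 < T 0) (hT : T 0 < T 1) :
    ContDiff ℝ ∞ (mixtureProfile d η T 0) := by
  have e : mixtureProfile d η T 0 =
      ProbabilityTheory.mgf (fun s => -(2 * s)⁻¹) (mixtureMeasure d η T) := by
    ext x
    simp only [ProbabilityTheory.mgf, integral_mixtureMeasure hη hT₀ hT, mixtureProfile, pow_zero,
      one_mul]
  rw [contDiff_iff_contDiffAt, e]
  intro x
  exact (ProbabilityTheory.analyticAt_mgf
    (by rw [interior_integrableExpSet_mixtureMeasure hη hT₀ hT]; trivial)).contDiffAt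

theorem contDiff_mixture (hη : ∀ j, 0 < η j) (hT₀ : 0 < T 0) (hT : T 0 < T 1) :
    ContDiff ℝ ∞ (mixture d η T) := by
  have h := contDiff_radial (contDiff_mixtureProfile_zero (d := d) hη hT₀ hT) (0 : Vel d)
  simpa only [sub_zero, ← mixture_eq_mixtureProfile] using h

theorem integrableOn_mixtureProfile (hη : ∀ j, 0 < η j) (hT₀ : 0 < T 0) (hT : T 0 < T 1) (n : ℕ)
    (x : ℝ) : IntegrableOn (fun s => weight η T s *
      ((2 * Real.pi * s) ^ (-(d : ℝ) / 2) * ((-(2 * s)⁻¹) ^ n * Real.exp (x * -(2 * s)⁻¹))))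
      (Set.Icc (T 0) (T 1)) := by
  have h1 := continuousOn_rpow_const_Icc (T := T) hT₀ (-(d : ℝ) / 2)
  have h2 := continuousOn_inv_Icc (T := T) hT₀
  exact integrableOn_weight_mul hη hT (by fun_prop)

theorem fokkerPlanck_mixture (hη : ∀ j, 0 < η j) (hT₀ : 0 < T 0) (hT : T 0 < T 1) (v : Vel d) :
    fokkerPlanck (limitTemp η T) (mixture d η T) v =
      totalRate η * mixture d η T v -
        (η 0 * maxwellian d (T 0) v + η 1 * maxwellian d (T 1) v) := by
  have hd := hasDerivAt_mixtureProfile (d := d) hη hT₀ hT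
  have hc := contDiff_mixtureProfile_zero (d := d) hη hT₀ hT
  have hi := integrableOn_mixtureProfile (d := d) hη hT₀ hT
  have e : mixture d η T = fun u => mixtureProfile d η T 0 (‖u - 0‖ ^ 2) := by
    ext u; rw [sub_zero, mixture_eq_mixtureProfile]
  have hL := laplacian_radial (contDiff_infty.1 hc 2) (hd 0) (hd 1) (0 : Vel d) v
  have hF := fderiv_radial_apply (hd 0) (0 : Vel d) v v
  rw [← e, sub_zero] at hL hF
  rw [fokkerPlanck, divergence_smul_id ((contDiff_mixture hη hT₀ hT).differentiable (by simp)),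
    hL, hF, real_inner_self_eq_norm_sq]
  have hpos : ∀ s ∈ Set.Icc (T 0) (T 1), 0 < s := fun s hs => hT₀.trans_le hs.1
  have hM (s : ℝ) (hs : s ∈ Set.Icc (T 0) (T 1)) := hasDerivAt_maxwellian d (hpos s hs) v
  have hMc : ContinuousOn (fun s => maxwellian d s v) (Set.Icc (T 0) (T 1)) :=
    fun s hs => (hM s hs).continuousAt.continuousWithinAt
  have hMc' : ContinuousOn (fun s : ℝ => (‖v‖ ^ 2 / (2 * s ^ 2) - d / (2 * s)) * maxwellian d s v)
      (Set.Icc (T 0) (T 1)) := by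
    refine ContinuousOn.mul (ContinuousOn.sub ?_ ?_) hMc
    · exact ContinuousOn.div (by fun_prop) (by fun_prop) fun s hs => by
        have := hpos s hs
        positivity
    · exact ContinuousOn.div (by fun_prop) (by fun_prop) fun s hs => by
        have := hpos s hs
        positivity
  have key := integral_weight_mul_deriv hη hT hMc hMc'
    fun s hs => hM s (Set.Ioo_subset_Icc_self hs)
  -- Both sides are `G_{T_∞}[g] - η g` for the mixture `g`: the left through `2 (T_∞ - s) ∂_s M_s`,
  -- the right through the derivatives of the radial profile.
  have hsplit : ∫ s in Set.Icc (T 0) (T 1),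
      (weight η T s * (2 * (limitTemp η T - s) *
        ((‖v‖ ^ 2 / (2 * s ^ 2) - d / (2 * s)) * maxwellian d s v)) -
        weight η T s * (totalRate η * maxwellian d s v)) =
      limitTemp η T * (4 * ‖v‖ ^ 2) * mixtureProfile d η T 2 (‖v‖ ^ 2) +
      (limitTemp η T * (2 * d) + 2 * ‖v‖ ^ 2) * mixtureProfile d η T 1 (‖v‖ ^ 2) +
      (d - totalRate η) * mixtureProfile d η T 0 (‖v‖ ^ 2) := by
    simp only [mixtureProfile]
    have i0 := (hi 0 (‖v‖ ^ 2)).const_mul (d - totalRate η)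
    have i1 := (hi 1 (‖v‖ ^ 2)).const_mul (limitTemp η T * (2 * d) + 2 * ‖v‖ ^ 2)
    have i2 := (hi 2 (‖v‖ ^ 2)).const_mul (limitTemp η T * (4 * ‖v‖ ^ 2))
    have i21 := i2.add i1
    simp only [Pi.add_def] at i21
    rw [← integral_const_mul, ← integral_const_mul, ← integral_const_mul, ← integral_add i2 i1,
      ← integral_add i21 i0]
    refine setIntegral_congr_fun measurableSet_Icc fun s hs => ?_
    have hs0 := (hpos s hs).ne'
    have e1 : -‖v‖ ^ 2 / (2 * s) = ‖v‖ ^ 2 * -(2 * s)⁻¹ := by field_simp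
    simp only [maxwellian, e1]
    generalize Real.exp (‖v‖ ^ 2 * -(2 * s)⁻¹) = E
    generalize (2 * Real.pi * s) ^ (-(d : ℝ) / 2) = C
    field_simp
    ring
  rw [hsplit] at key
  rw [mixture_eq_mixtureProfile]
  linear_combination key

theorem mixture_nonneg (hη : ∀ j, 0 < η j) (hT₀ : 0 < T 0) (hT : T 0 < T 1) (v : Vel d) :
    0 ≤ mixture d η T v :=
  setIntegral_nonneg measurableSet_Icc fun s hs =>
    mul_nonneg (weight_nonneg hη hT s) (maxwellian_nonneg d (hT₀.trans_le hs.1).le v)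

theorem integrable_weight_mul_maxwellian (hη : ∀ j, 0 < η j) (hT₀ : 0 < T 0) (hT : T 0 < T 1) :
    Integrable (fun p : ℝ × Vel d => weight η T p.1 * maxwellian d p.1 p.2)
      ((volume.restrict (Set.Icc (T 0) (T 1))).prod volume) := by
  have hm : Measurable fun p : ℝ × Vel d => weight η T p.1 * maxwellian d p.1 p.2 := by
    have := measurable_weight η T
    unfold maxwellian
    fun_prop
  rw [integrable_prod_iff hm.aestronglyMeasurable]
  constructor
  · filter_upwards [ae_restrict_mem measurableSet_Icc] with s hs
    exact (integrable_maxwellian d (hT₀.trans_le hs.1)).const_mul _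
  · refine (integrableOn_weight hη hT).congr ?_
    filter_upwards [ae_restrict_mem measurableSet_Icc] with s hs
    have hs0 := hT₀.trans_le hs.1
    simp only [norm_mul, Real.norm_of_nonneg (weight_nonneg hη hT s),
      Real.norm_of_nonneg (maxwellian_nonneg d hs0.le _)]
    rw [integral_const_mul, integral_maxwellian d hs0, mul_one]

theorem integrable_mixture (hη : ∀ j, 0 < η j) (hT₀ : 0 < T 0) (hT : T 0 < T 1) :
    Integrable (mixture d η T) :=
  (integrable_weight_mul_maxwellian hη hT₀ hT).integral_prod_right

theorem integral_mixture (hη : ∀ j, 0 < η j) (hT₀ : 0 < T 0) (hT : T 0 < T 1) :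
    ∫ v, mixture d η T v = 1 := by
  unfold mixture
  rw [← integral_integral_swap (integrable_weight_mul_maxwellian hη hT₀ hT),
    ← integral_weight hη hT]
  refine setIntegral_congr_fun measurableSet_Icc fun s hs => ?_
  rw [integral_const_mul, integral_maxwellian d (hT₀.trans_le hs.1), mul_one]

theorem isClassicalSteadyState_mixture (hη : ∀ j, 0 < η j) (hT₀ : 0 < T 0) (hT : T 0 < T 1) :
    IsClassicalSteadyState η T (mixture d η T) := by
  refine fun t _ => ⟨integrable_mixture hη hT₀ hT,
    contDiff_infty.1 (contDiff_mixture hη hT₀ hT) 2, fun v => ?_⟩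
  refine (hasDerivAt_const t (mixture d η T v)).congr_deriv ?_
  rw [fokkerPlanck_mixture hη hT₀ hT]
  simp only [reservoir, integral_mixture hη hT₀ hT, totalRate, Fin.sum_univ_two]
  ring

end Profile

/-! ### Uniqueness: admitting Gaussian test functions -/

open Filter Topology

theorem one_add_mul_exp_neg_le {β x : ℝ} (hβ : 0 < β) (hx : 0 ≤ x) :
    (1 + x) * Real.exp (-β * x) ≤ 1 + 1 / β := by
  have h1 : Real.exp (-β * x) ≤ 1 := Real.exp_le_one_iff.2 (by nlinarith)
  have h2 : β * x * Real.exp (-β * x) ≤ 1 := by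
    rw [neg_mul, Real.exp_neg, ← div_eq_mul_inv, div_le_one (Real.exp_pos _)]
    linarith [Real.add_one_le_exp (β * x)]
  have h3 : x * Real.exp (-β * x) ≤ 1 / β := by
    rw [le_div_iff₀ hβ]
    linarith
  linarith

/-- Domination for removing the cut-off. Here `e` stands for `exp (-β x)`, and `a₀`, `a₁`, `a₂` for
what remains of the cut-off profile and its first two derivatives. The bound depends on the cut-off
only through `K`, and `(1 + x) e` is bounded, so integrability of `h` suffices. -/
theorem abs_adjoint_radial_le {τ σ e x a₀ a₁ a₂ p K c : ℝ} (d : ℕ) (hτ : 0 ≤ τ) (hσ : 0 ≤ σ)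
    (he : 0 ≤ e) (hx : 0 ≤ x) (h₀ : |a₀| ≤ K) (h₁ : |a₁| ≤ K) (h₂ : |a₂| ≤ K)
    (hp : |p| ≤ (1 + c) * (1 + x)) :
    |τ * (4 * x * (e * a₂) + 2 * d * (e * a₁)) - 2 * (e * a₁) * p - σ * (e * a₀)| ≤
      (τ * (4 * K + 2 * d * K) + 2 * K * (1 + c) + σ * K) * ((1 + x) * e) := by
  have hK : 0 ≤ K := (abs_nonneg _).trans h₀
  have t2 : |x * a₂| ≤ (1 + x) * K := by
    rw [abs_mul, abs_of_nonneg hx]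
    exact mul_le_mul (by linarith) h₂ (abs_nonneg _) (by linarith)
  have t1 : |a₁| ≤ (1 + x) * K := h₁.trans (by nlinarith)
  have t0 : |a₀| ≤ (1 + x) * K := h₀.trans (by nlinarith)
  have tp : |a₁ * p| ≤ K * ((1 + c) * (1 + x)) := by
    rw [abs_mul]
    exact mul_le_mul h₁ hp (abs_nonneg _) hK
  have key : |τ * (4 * (x * a₂) + 2 * d * a₁) - 2 * (a₁ * p) - σ * a₀| ≤
      τ * (4 * ((1 + x) * K) + 2 * d * ((1 + x) * K)) + 2 * (K * ((1 + c) * (1 + x))) +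
        σ * ((1 + x) * K) := by
    have s1 : |τ * (4 * (x * a₂) + 2 * d * a₁)| ≤
        τ * (4 * ((1 + x) * K) + 2 * d * ((1 + x) * K)) := by
      rw [abs_mul, abs_of_nonneg hτ]
      refine mul_le_mul_of_nonneg_left ((abs_add_le _ _).trans (add_le_add ?_ ?_)) hτ
      · rw [abs_mul, abs_of_pos (by norm_num : (0 : ℝ) < 4)]
        linarith
      · rw [abs_mul, abs_of_nonneg (by positivity : (0 : ℝ) ≤ 2 * d)]
        gcongr
    have s2 : |2 * (a₁ * p)| ≤ 2 * (K * ((1 + c) * (1 + x))) := by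
      rw [abs_mul, abs_of_pos (by norm_num : (0 : ℝ) < 2)]
      linarith
    have s3 : |σ * a₀| ≤ σ * ((1 + x) * K) := by
      rw [abs_mul, abs_of_nonneg hσ]
      gcongr
    exact (abs_sub _ _).trans (add_le_add ((abs_sub _ _).trans (add_le_add s1 s2)) s3)
  calc _ = |(τ * (4 * (x * a₂) + 2 * d * a₁) - 2 * (a₁ * p) - σ * a₀) * e| := by
        congr 1; ring
    _ ≤ (τ * (4 * ((1 + x) * K) + 2 * d * ((1 + x) * K)) + 2 * (K * ((1 + c) * (1 + x))) +
        σ * ((1 + x) * K)) * e := by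
        rw [abs_mul, abs_of_nonneg he]
        exact mul_le_mul_of_nonneg_right key he
    _ = _ := by ring

theorem abs_inner_sub_self_le {d : ℕ} (c v : Vel d) :
    |inner ℝ (v - c) v| ≤ (1 + ‖c‖) * (1 + ‖v - c‖ ^ 2) := by
  have h1 := abs_real_inner_le_norm (v - c) v
  have h2 : ‖v‖ ≤ ‖v - c‖ + ‖c‖ := by simpa using norm_add_le (v - c) c
  have h3 := norm_nonneg (v - c)
  have h4 := norm_nonneg c
  have h5 : ‖v - c‖ * ‖v‖ ≤ ‖v - c‖ * (‖v - c‖ + ‖c‖) := mul_le_mul_of_nonneg_left h2 h3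
  nlinarith [mul_nonneg h4 (sq_nonneg (‖v - c‖ - 1)), mul_nonneg h3 h4, sq_nonneg ‖v - c‖,
    mul_nonneg h4 (sq_nonneg ‖v - c‖)]

/-- A function annihilated by the adjoint `τ Δφ - v · ∇φ - σ φ` on test functions. -/
def IsWeakKernel {d : ℕ} (τ σ : ℝ) (h : Vel d → ℝ) : Prop :=
  ∀ φ : Vel d → ℝ, ContDiff ℝ ∞ φ → HasCompactSupport φ →
    ∫ v, h v * (τ * laplacian φ v - fderiv ℝ φ v v - σ * φ v) = 0

variable {d : ℕ} {τ σ : ℝ} {h : Vel d → ℝ}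

/-- Weak solutions of the stationary equation may be tested against Gaussians. -/
theorem IsWeakKernel.integral_gaussian (hk : IsWeakKernel τ σ h) (hh : Integrable h) (hτ : 0 ≤ τ)
    (hσ : 0 ≤ σ) {β : ℝ} (hβ : 0 < β) (c : Vel d) :
    ∫ v, h v * (τ * (4 * ‖v - c‖ ^ 2 * (Real.exp (-β * ‖v - c‖ ^ 2) * β ^ 2) +
      2 * d * (Real.exp (-β * ‖v - c‖ ^ 2) * -β)) -
      2 * (Real.exp (-β * ‖v - c‖ ^ 2) * -β) * inner ℝ (v - c) v -
      σ * (Real.exp (-β * ‖v - c‖ ^ 2) * 1)) = 0 := by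
  obtain ⟨χ, hχ, hχs, hχ0, hχ2⟩ : ∃ χ : ℝ → ℝ, ContDiff ℝ ∞ χ ∧ HasCompactSupport χ ∧ χ 0 = 1 ∧
      ∀ x, χ x ≠ 0 → |x| < 2 := by
    let χ : ContDiffBump (0 : ℝ) := ⟨1, 2, one_pos, one_lt_two⟩
    refine ⟨χ, χ.contDiff, χ.hasCompactSupport, χ.one_of_mem_closedBall (by simp [χ]),
      fun x hx => ?_⟩
    have h2 : x ∈ Metric.ball (0 : ℝ) 2 := by rw [← χ.support_eq]; exact hx
    rwa [Metric.mem_ball, dist_zero_right, Real.norm_eq_abs] at h2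
  have hχ1 : ContDiff ℝ ∞ (deriv χ) := hχ.deriv'
  have hχ2' : ContDiff ℝ ∞ (deriv (deriv χ)) := hχ1.deriv'
  obtain ⟨K₀, hK₀⟩ := hχs.exists_bound_of_continuous hχ.continuous
  obtain ⟨K₁, hK₁⟩ := hχs.deriv.exists_bound_of_continuous hχ1.continuous
  obtain ⟨K₂, hK₂⟩ := hχs.deriv.deriv.exists_bound_of_continuous hχ2'.continuous
  simp only [Real.norm_eq_abs] at hK₀ hK₁ hK₂
  have hK₀' : 0 ≤ K₀ := (abs_nonneg _).trans (hK₀ 0)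
  have hK₁' : 0 ≤ K₁ := (abs_nonneg _).trans (hK₁ 0)
  have hK₂' : 0 ≤ K₂ := (abs_nonneg _).trans (hK₂ 0)
  -- The cut-off is `χ (r n * ‖v - c‖ ^ 2)`. Each derivative falling on `χ` costs a factor `r n ≤
  -- 1`, so the bounds are uniform in `n` and the extra terms vanish in the limit.
  let r : ℕ → ℝ := fun n => ((n : ℝ) + 1)⁻¹
  have hr0 (n : ℕ) : 0 < r n := by positivity
  have hr1 (n : ℕ) : r n ≤ 1 := inv_le_one_of_one_le₀ (by simp)
  have hr : Tendsto r atTop (𝓝 0) := by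
    simpa [r, one_div] using tendsto_one_div_add_atTop_nhds_zero_nat (𝕜 := ℝ)
  let A₀ : ℕ → ℝ → ℝ := fun n x => χ (r n * x)
  let A₁ : ℕ → ℝ → ℝ := fun n x => -β * χ (r n * x) + r n * deriv χ (r n * x)
  let A₂ : ℕ → ℝ → ℝ := fun n x => β ^ 2 * χ (r n * x) - 2 * β * (r n * deriv χ (r n * x)) +
    r n * (r n * deriv (deriv χ) (r n * x))
  let F : ℕ → ℝ → ℝ := fun n x => Real.exp (-β * x) * A₀ n x
  let F' : ℕ → ℝ → ℝ := fun n x => Real.exp (-β * x) * A₁ n x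
  let F'' : ℕ → ℝ → ℝ := fun n x => Real.exp (-β * x) * A₂ n x
  have hexp (x : ℝ) : HasDerivAt (fun x => Real.exp (-β * x)) (Real.exp (-β * x) * -β) x := by
    simpa using ((hasDerivAt_id x).const_mul (-β)).exp
  have hmul (n : ℕ) (x : ℝ) : HasDerivAt (fun x => r n * x) (r n) x := by
    simpa using (hasDerivAt_id x).const_mul (r n)
  have hd0 (n : ℕ) (x : ℝ) : HasDerivAt (fun x => χ (r n * x)) (deriv χ (r n * x) * r n) x :=
    HasDerivAt.comp x ((hχ.differentiable (by simp) _).hasDerivAt) (hmul n x)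
  have hd1 (n : ℕ) (x : ℝ) :
      HasDerivAt (fun x => deriv χ (r n * x)) (deriv (deriv χ) (r n * x) * r n) x :=
    HasDerivAt.comp x ((hχ1.differentiable (by simp) _).hasDerivAt) (hmul n x)
  have hF (n : ℕ) : ContDiff ℝ ∞ (F n) := by
    have h1 : ContDiff ℝ ∞ fun x : ℝ => Real.exp (-β * x) := by fun_prop
    exact h1.mul (hχ.comp (contDiff_const.mul contDiff_id))
  have hF' (n : ℕ) (x : ℝ) : HasDerivAt (F n) (F' n x) x := by
    refine ((hexp x).fun_mul (hd0 n x)).congr_deriv ?_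
    simp only [F', A₁]
    ring
  have hF'' (n : ℕ) (x : ℝ) : HasDerivAt (F' n) (F'' n x) x := by
    refine ((hexp x).fun_mul (((hd0 n x).const_mul (-β)).fun_add
      ((hd1 n x).const_mul (r n)))).congr_deriv ?_
    simp only [F'', A₂]
    ring
  let K : ℝ := max K₀ (max (β * K₀ + K₁) (β ^ 2 * K₀ + 2 * β * K₁ + K₂))
  have hrK {n : ℕ} {k y : ℝ} (hy : |y| ≤ k) : |r n * y| ≤ k := by
    rw [abs_mul, abs_of_pos (hr0 n)]
    exact (mul_le_of_le_one_left (abs_nonneg _) (hr1 n)).trans hy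
  have hA₀ (n : ℕ) (x : ℝ) : |A₀ n x| ≤ K := (hK₀ _).trans (le_max_left _ _)
  have hA₁ (n : ℕ) (x : ℝ) : |A₁ n x| ≤ K := by
    refine le_trans ?_ ((le_max_left _ _).trans (le_max_right _ _))
    refine (abs_add_le _ _).trans (add_le_add ?_ (hrK (hK₁ _)))
    rw [abs_mul, abs_neg, abs_of_pos hβ]
    exact mul_le_mul_of_nonneg_left (hK₀ _) hβ.le
  have hA₂ (n : ℕ) (x : ℝ) : |A₂ n x| ≤ K := by
    refine le_trans ?_ ((le_max_right _ _).trans (le_max_right _ _))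
    refine (abs_add_le _ _).trans (add_le_add ((abs_sub _ _).trans (add_le_add ?_ ?_))
      (hrK (hrK (hK₂ _))))
    · rw [abs_mul, abs_of_pos (pow_pos hβ 2)]
      exact mul_le_mul_of_nonneg_left (hK₀ _) (by positivity)
    · rw [abs_mul, abs_of_pos (by positivity : 0 < 2 * β)]
      exact mul_le_mul_of_nonneg_left (hrK (hK₁ _)) (by positivity)
  have hzero (n : ℕ) : ∫ v, h v * (τ * (4 * ‖v - c‖ ^ 2 * F'' n (‖v - c‖ ^ 2) +
      2 * d * F' n (‖v - c‖ ^ 2)) - 2 * F' n (‖v - c‖ ^ 2) * inner ℝ (v - c) v -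
      σ * F n (‖v - c‖ ^ 2)) = 0 := by
    have hcs : HasCompactSupport fun v : Vel d => F n (‖v - c‖ ^ 2) := by
      refine HasCompactSupport.of_support_subset_isCompact
        (isCompact_closedBall c ((n : ℝ) + 2)) fun v hv => ?_
      have h1 : χ (r n * ‖v - c‖ ^ 2) ≠ 0 := right_ne_zero_of_mul hv
      have h3 := (le_abs_self _).trans_lt (hχ2 _ h1)
      -- The support satisfies `‖v - c‖ ^ 2 < 2 (n + 1)`, which is below `(n + 2) ^ 2`.
      simp only [r] at h3
      rw [inv_mul_lt_iff₀ (by positivity)] at h3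
      rw [Metric.mem_closedBall, dist_eq_norm]
      have : (0 : ℝ) ≤ n := n.cast_nonneg
      nlinarith [norm_nonneg (v - c)]
    rw [← hk _ (contDiff_radial (hF n) c) hcs]
    congr 1 with v
    rw [laplacian_radial (contDiff_infty.1 (hF n) 2) (hF' n) (hF'' n),
      fderiv_radial_apply (hF' n)]
  refine tendsto_nhds_unique (tendsto_integral_of_dominated_convergence
    (F := fun n v => h v * (τ * (4 * ‖v - c‖ ^ 2 * F'' n (‖v - c‖ ^ 2) +
      2 * d * F' n (‖v - c‖ ^ 2)) - 2 * F' n (‖v - c‖ ^ 2) * inner ℝ (v - c) v -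
      σ * F n (‖v - c‖ ^ 2)))
    (fun v => ‖h v‖ * ((τ * (4 * K + 2 * d * K) + 2 * K * (1 + ‖c‖) + σ * K) * (1 + 1 / β)))
    ?_ (hh.norm.mul_const _) ?_ ?_) ?_
  · intro n
    have c0 := hχ.continuous
    have c1 := hχ1.continuous
    have c2 := hχ2'.continuous
    refine hh.aestronglyMeasurable.mul (Continuous.aestronglyMeasurable ?_)
    simp only [F, F', F'', A₀, A₁, A₂]
    fun_prop
  · refine fun n => .of_forall fun v => ?_
    rw [norm_mul]
    refine mul_le_mul_of_nonneg_left ?_ (norm_nonneg _)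
    have hK : 0 ≤ K := hK₀'.trans (le_max_left _ _)
    exact (abs_adjoint_radial_le d hτ hσ (Real.exp_pos _).le (sq_nonneg _)
      (hA₀ n _) (hA₁ n _) (hA₂ n _) (abs_inner_sub_self_le c v)).trans
      (mul_le_mul_of_nonneg_left (one_add_mul_exp_neg_le hβ (sq_nonneg _)) (by positivity))
  · refine .of_forall fun v => ?_
    have hx : Tendsto (fun n => r n * ‖v - c‖ ^ 2) atTop (𝓝 0) := by
      simpa using hr.mul_const (‖v - c‖ ^ 2)
    have t0 := (hχ.continuous.tendsto 0).comp hx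
    have t1 := (hχ1.continuous.tendsto 0).comp hx
    have t2 := (hχ2'.continuous.tendsto 0).comp hx
    rw [hχ0] at t0
    have a1 : Tendsto (fun n => A₁ n (‖v - c‖ ^ 2)) atTop (𝓝 (-β)) := by
      simpa [A₁] using (t0.const_mul (-β)).add (hr.mul t1)
    have a2 : Tendsto (fun n => A₂ n (‖v - c‖ ^ 2)) atTop (𝓝 (β ^ 2)) := by
      simpa [A₂] using ((t0.const_mul (β ^ 2)).sub ((hr.mul t1).const_mul (2 * β))).add
        (hr.mul (hr.mul t2))
    have f0 := t0.const_mul (Real.exp (-β * ‖v - c‖ ^ 2))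
    have f1 := a1.const_mul (Real.exp (-β * ‖v - c‖ ^ 2))
    have f2 := a2.const_mul (Real.exp (-β * ‖v - c‖ ^ 2))
    exact (((((f2.const_mul _).add (f1.const_mul _)).const_mul τ).sub
      ((f1.const_mul 2).mul_const _)).sub (f0.const_mul σ)).const_mul (h v)
  · simp only [hzero]
    exact tendsto_const_nhds

/-! ### Gaussians along the Ornstein-Uhlenbeck flow -/

/-- The Gaussian `exp(-|λ v - a|² / (2B))`. -/
def dilatedGaussian (a : Vel d) (B l : ℝ) (v : Vel d) : ℝ :=
  Real.exp (-‖l • v - a‖ ^ 2 / (2 * B))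

theorem dilatedGaussian_le_one (a : Vel d) {B : ℝ} (hB : 0 ≤ B) (l : ℝ) (v : Vel d) :
    dilatedGaussian a B l v ≤ 1 :=
  Real.exp_le_one_iff.2 (div_nonpos_of_nonpos_of_nonneg (by simp) (by positivity))

theorem dilatedGaussian_pos (a : Vel d) (B l : ℝ) (v : Vel d) : 0 < dilatedGaussian a B l v :=
  Real.exp_pos _

theorem continuous_dilatedGaussian (a : Vel d) (B l : ℝ) :
    Continuous (dilatedGaussian a B l) := by
  unfold dilatedGaussian; fun_prop

theorem integrable_mul_dilatedGaussian (hh : Integrable h) (a : Vel d) {B : ℝ} (hB : 0 ≤ B)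
    (l : ℝ) : Integrable fun v => h v * dilatedGaussian a B l v := by
  refine hh.mul_bdd (c := 1) (continuous_dilatedGaussian a B l).aestronglyMeasurable ?_
  refine .of_forall fun v => ?_
  rw [Real.norm_of_nonneg (dilatedGaussian_pos ..).le]
  exact dilatedGaussian_le_one a hB l v

/-- This is `IsWeakKernel.integral_gaussian` with centre `a / l` and `β = l² / (2B)`, rewritten in
`l • v - a`, a form that survives `l → 0`. -/
theorem IsWeakKernel.integral_dilatedGaussian (hk : IsWeakKernel τ σ h) (hh : Integrable h)
    (hτ : 0 ≤ τ) (hσ : 0 ≤ σ) {B l : ℝ} (hB : 0 < B) (hl : 0 < l) (a : Vel d) :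
    ∫ v, h v * (dilatedGaussian a B l v * (τ * l ^ 2 * ‖l • v - a‖ ^ 2 / B ^ 2 -
      d * τ * l ^ 2 / B + l * inner ℝ (l • v - a) v / B - σ)) = 0 := by
  rw [← hk.integral_gaussian hh hτ hσ (β := l ^ 2 / (2 * B)) (by positivity) (l⁻¹ • a)]
  congr 1 with v
  have e : v - l⁻¹ • a = l⁻¹ • (l • v - a) := by
    rw [smul_sub, inv_smul_smul₀ hl.ne']
  have e1 : ‖v - l⁻¹ • a‖ ^ 2 = ‖l • v - a‖ ^ 2 / l ^ 2 := by
    rw [e, norm_smul, mul_pow, norm_inv, inv_pow, Real.norm_of_nonneg hl.le]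
    ring
  have e2 : inner ℝ (v - l⁻¹ • a) v = inner ℝ (l • v - a) v / l := by
    rw [e, real_inner_smul_left]
    ring
  have e3 : -(l ^ 2 / (2 * B)) * (‖l • v - a‖ ^ 2 / l ^ 2) = -‖l • v - a‖ ^ 2 / (2 * B) := by
    field_simp
  rw [e1, e2, e3, dilatedGaussian]
  field_simp
  ring

theorem hasDerivAt_dilatedGaussian (a v : Vel d) {B₀ l : ℝ} (hB : 0 < B₀ - τ * l ^ 2) :
    HasDerivAt (fun l => dilatedGaussian a (B₀ - τ * l ^ 2) l v)
      (-(dilatedGaussian a (B₀ - τ * l ^ 2) l v *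
        (inner ℝ (l • v - a) v / (B₀ - τ * l ^ 2) +
          τ * l * ‖l • v - a‖ ^ 2 / (B₀ - τ * l ^ 2) ^ 2))) l := by
  have h1 : HasDerivAt (fun l : ℝ => ‖l • v - a‖ ^ 2) (2 * inner ℝ (l • v - a) v) l := by
    have := (((hasDerivAt_id l).smul_const v).sub_const a).norm_sq
    simpa using this
  have h2 : HasDerivAt (fun l : ℝ => 2 * (B₀ - τ * l ^ 2)) (2 * -(τ * (2 * l))) l := by
    have := (((hasDerivAt_pow 2 l).const_mul τ).const_sub B₀).const_mul 2
    simpa using this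
  refine ((h1.fun_neg.fun_div h2 (by positivity)).exp).congr_deriv ?_
  unfold dilatedGaussian
  field_simp
  ring

theorem abs_deriv_dilatedGaussian_le (a v : Vel d) {B₀ B B₁ l l₁ l₂ : ℝ} (hτ : 0 ≤ τ) (hB₁ : 0 < B₁)
    (hB : B₁ ≤ B) (hB' : B ≤ B₀) (hl₁ : 0 < l₁) (hl : l₁ ≤ l) (hl' : l ≤ l₂) :
    |-(dilatedGaussian a B l v * (inner ℝ (l • v - a) v / B + τ * l * ‖l • v - a‖ ^ 2 / B ^ 2))| ≤
      ((1 + ‖a‖) / (l₁ * B₁) + τ * l₂ / B₁ ^ 2) * (1 + 1 / (2 * B₀)⁻¹) := by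
  have hl0 : 0 < l := hl₁.trans_le hl
  have hB0 : 0 < B := hB₁.trans_le hB
  have hB0' : 0 < B₀ := hB0.trans_le hB'
  have hl2 : 0 < l₂ := hl0.trans_le hl'
  set y := l • v - a with hy
  -- Expressing `v` through `y` lets the Gaussian decay in `y` control the factor `v`. This is where
  -- `l` must stay away from `0`.
  have hv : v = l⁻¹ • (y - (-a)) := by
    rw [hy, sub_neg_eq_add, sub_add_cancel, inv_smul_smul₀ hl0.ne']
  have hi : |inner ℝ y v| ≤ (1 + ‖a‖) * (1 + ‖y‖ ^ 2) / l₁ := by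
    have h1 : inner ℝ y v = l⁻¹ * inner ℝ (y + a - a) (y + a) := by
      conv_lhs => rw [hv, real_inner_smul_right]
      simp
    have h2 := abs_inner_sub_self_le a (y + a)
    rw [add_sub_cancel_right] at h2
    rw [h1, abs_mul, abs_of_pos (inv_pos.2 hl0), add_sub_cancel_right, div_eq_inv_mul]
    gcongr
  have hE : dilatedGaussian a B l v ≤ Real.exp (-(2 * B₀)⁻¹ * ‖y‖ ^ 2) := by
    refine Real.exp_le_exp.2 ?_
    rw [neg_mul, neg_div, neg_le_neg_iff, ← div_eq_inv_mul]
    gcongr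
  have h3 : |inner ℝ y v / B| ≤ (1 + ‖a‖) / (l₁ * B₁) * (1 + ‖y‖ ^ 2) := by
    rw [abs_div, abs_of_pos hB0]
    calc _ ≤ (1 + ‖a‖) * (1 + ‖y‖ ^ 2) / l₁ / B₁ := by gcongr
      _ = _ := by field_simp
  have h4 : |τ * l * ‖y‖ ^ 2 / B ^ 2| ≤ τ * l₂ / B₁ ^ 2 * (1 + ‖y‖ ^ 2) := by
    rw [abs_of_nonneg (by positivity)]
    calc _ ≤ τ * l₂ * (1 + ‖y‖ ^ 2) / B₁ ^ 2 := by
          gcongr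
          linarith
      _ = _ := by ring
  rw [abs_neg, abs_mul, abs_of_pos (dilatedGaussian_pos ..)]
  calc _ ≤ Real.exp (-(2 * B₀)⁻¹ * ‖y‖ ^ 2) *
        ((1 + ‖a‖) / (l₁ * B₁) * (1 + ‖y‖ ^ 2) + τ * l₂ / B₁ ^ 2 * (1 + ‖y‖ ^ 2)) := by
        gcongr
        exact (abs_add_le _ _).trans (add_le_add h3 h4)
    _ = ((1 + ‖a‖) / (l₁ * B₁) + τ * l₂ / B₁ ^ 2) *
        ((1 + ‖y‖ ^ 2) * Real.exp (-(2 * B₀)⁻¹ * ‖y‖ ^ 2)) := by ring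
    _ ≤ _ := by
        have := one_add_mul_exp_neg_le (β := (2 * B₀)⁻¹) (by positivity) (sq_nonneg ‖y‖)
        gcongr

theorem hasDerivAt_integral_mul_dilatedGaussian (hh : Integrable h) (hτ : 0 ≤ τ) (a : Vel d)
    {B₀ l : ℝ} (hl : 0 < l) (hB : 0 < B₀ - τ * l ^ 2) :
    Integrable (fun v => h v * -(dilatedGaussian a (B₀ - τ * l ^ 2) l v *
        (inner ℝ (l • v - a) v / (B₀ - τ * l ^ 2) +
          τ * l * ‖l • v - a‖ ^ 2 / (B₀ - τ * l ^ 2) ^ 2))) ∧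
    HasDerivAt (fun l => ∫ v, h v * dilatedGaussian a (B₀ - τ * l ^ 2) l v)
      (∫ v, h v * -(dilatedGaussian a (B₀ - τ * l ^ 2) l v *
        (inner ℝ (l • v - a) v / (B₀ - τ * l ^ 2) +
          τ * l * ‖l • v - a‖ ^ 2 / (B₀ - τ * l ^ 2) ^ 2))) l := by
  have hcont : Continuous fun l : ℝ => B₀ - τ * l ^ 2 := by fun_prop
  have hs : {x | l / 2 < x ∧ x < 2 * l ∧ (B₀ - τ * l ^ 2) / 2 < B₀ - τ * x ^ 2} ∈ 𝓝 l := by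
    filter_upwards [lt_mem_nhds (half_lt_self hl), gt_mem_nhds (by linarith : l < 2 * l),
      hcont.continuousAt.eventually (lt_mem_nhds (half_lt_self hB))] with x h1 h2 h3
    exact ⟨h1, h2, h3⟩
  refine hasDerivAt_integral_of_dominated_loc_of_deriv_le (𝕜 := ℝ) hs
    (F := fun l v => h v * dilatedGaussian a (B₀ - τ * l ^ 2) l v)
    (F' := fun l v => h v * -(dilatedGaussian a (B₀ - τ * l ^ 2) l v *
        (inner ℝ (l • v - a) v / (B₀ - τ * l ^ 2) +
          τ * l * ‖l • v - a‖ ^ 2 / (B₀ - τ * l ^ 2) ^ 2)))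
    (bound := fun v => ‖h v‖ * (((1 + ‖a‖) / (l / 2 * ((B₀ - τ * l ^ 2) / 2)) +
      τ * (2 * l) / ((B₀ - τ * l ^ 2) / 2) ^ 2) * (1 + 1 / (2 * B₀)⁻¹)))
    ?_ ?_ ?_ ?_ (hh.norm.mul_const _) ?_
  · exact .of_forall fun x =>
      hh.aestronglyMeasurable.mul (continuous_dilatedGaussian _ _ _).aestronglyMeasurable
  · exact integrable_mul_dilatedGaussian hh a hB.le l
  · refine hh.aestronglyMeasurable.mul (Continuous.aestronglyMeasurable ?_)
    have := continuous_dilatedGaussian a (B₀ - τ * l ^ 2) l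
    fun_prop
  · refine .of_forall fun v x hx => ?_
    rw [norm_mul]
    refine mul_le_mul_of_nonneg_left ?_ (norm_nonneg _)
    exact abs_deriv_dilatedGaussian_le a v hτ (by positivity) hx.2.2.le
      (sub_le_self _ (by positivity)) (by positivity) hx.1.le hx.2.1.le
  · exact .of_forall fun v x hx => (hasDerivAt_dilatedGaussian a v
      ((by positivity : 0 < (B₀ - τ * l ^ 2) / 2).trans hx.2.2)).const_mul (h v)

/-- An integrable weak solution of `τ Δh + div(v h) = σ h` with `σ > 0` is orthogonal to all
Gaussians: along the Ornstein-Uhlenbeck flow of a Gaussian its pairing would grow exponentially. -/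
theorem IsWeakKernel.integral_mul_exp_eq_zero (hk : IsWeakKernel τ σ h) (hh : Integrable h)
    (hτ : 0 ≤ τ) (hσ : 0 < σ) {s : ℝ} (hs : 0 < s) (a : Vel d) :
    ∫ v, h v * Real.exp (-‖v - a‖ ^ 2 / (2 * s)) = 0 := by
  -- With `l = e^{-t}`, the flow of `τ Δ - v · ∇` carries `exp(-|v - a|² / (2s))` at time `t` to `(s
  -- / b l)^{d/2}` times `dilatedGaussian a (b l) l`. Up to the constant `s^{d/2}`, `Q l` is thus
  -- `e^{-σt}` times the pairing of `h` with the flowed Gaussian. It is constant on `(0, 1]`, and `l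
  -- = 1` is the initial Gaussian.
  let b : ℝ → ℝ := fun l => s + τ - τ * l ^ 2
  let J : ℝ → ℝ := fun l => ∫ v, h v * dilatedGaussian a (b l) l v
  let Q : ℝ → ℝ := fun l => l ^ σ * (b l) ^ (-(d : ℝ) / 2) * J l
  have hb {l : ℝ} (h0 : 0 < l) (h1 : l ≤ 1) : s ≤ b l := by
    have : l ^ 2 ≤ 1 := pow_le_one₀ h0.le h1
    simp only [b]
    nlinarith
  have hQ {l : ℝ} (h0 : 0 < l) (h1 : l ≤ 1) : HasDerivAt Q 0 l := by
    have hbl : 0 < b l := hs.trans_le (hb h0 h1)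
    obtain ⟨hi, hJ⟩ := hasDerivAt_integral_mul_dilatedGaussian hh hτ a h0 hbl
    have hd1 : HasDerivAt (fun l : ℝ => l ^ σ) (σ * l ^ (σ - 1)) l :=
      Real.hasDerivAt_rpow_const (Or.inl h0.ne')
    have hd2 : HasDerivAt b (-(τ * (2 * l))) l := by
      simpa using ((hasDerivAt_pow 2 l).const_mul τ).const_sub (s + τ)
    have hd3 := hd2.rpow_const (p := -(d : ℝ) / 2) (Or.inl hbl.ne')
    refine ((hd1.fun_mul hd3).fun_mul hJ).congr_deriv ?_
    have hw := hk.integral_dilatedGaussian hh hτ hσ.le hbl h0 a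
    have hsplit : ∫ v, h v * (dilatedGaussian a (b l) l v * (τ * l ^ 2 * ‖l • v - a‖ ^ 2 / b l ^ 2 -
        d * τ * l ^ 2 / b l + l * inner ℝ (l • v - a) v / b l - σ)) =
        -l * (∫ v, h v * -(dilatedGaussian a (b l) l v * (inner ℝ (l • v - a) v / b l +
          τ * l * ‖l • v - a‖ ^ 2 / b l ^ 2))) - (d * τ * l ^ 2 / b l + σ) * J l := by
      rw [← integral_const_mul, ← integral_const_mul, ← integral_sub (hi.const_mul _)
        ((integrable_mul_dilatedGaussian hh a hbl.le l).const_mul _)]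
      congr 1 with v
      ring
    rw [hsplit] at hw
    rw [Real.rpow_sub_one h0.ne', Real.rpow_sub_one hbl.ne']
    change _ + _ * (∫ v, h v * -(dilatedGaussian a (b l) l v * (inner ℝ (l • v - a) v / b l +
          τ * l * ‖l • v - a‖ ^ 2 / b l ^ 2))) = 0
    change _ * J l + _ = 0
    generalize (∫ v, h v * -(dilatedGaussian a (b l) l v * (inner ℝ (l • v - a) v / b l +
          τ * l * ‖l • v - a‖ ^ 2 / b l ^ 2))) = J' at hw ⊢
    generalize b l ^ (-(d : ℝ) / 2) = p
    field_simp at hw ⊢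
    linear_combination -(l ^ σ * p) * hw
  have hconst {ε : ℝ} (h0 : 0 < ε) (h1 : ε ≤ 1) : Q 1 = Q ε :=
    constant_of_has_deriv_right_zero
      (fun x hx => (hQ (h0.trans_le hx.1) hx.2).continuousAt.continuousWithinAt)
      (fun x hx => (hQ (h0.trans_le hx.1) hx.2.le).hasDerivWithinAt) 1 ⟨h1, le_rfl⟩
  -- Since `b ε ≥ s` and the Gaussian is at most `1`, everything but `ε ^ σ` is bounded; this factor
  -- forces the constant to be `0`.
  have hbound {ε : ℝ} (h0 : 0 < ε) (h1 : ε ≤ 1) :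
      ‖Q ε‖ ≤ ε ^ σ * (s ^ (-(d : ℝ) / 2) * ∫ v, ‖h v‖) := by
    have hbl : 0 < b ε := hs.trans_le (hb h0 h1)
    have hJ : ‖J ε‖ ≤ ∫ v, ‖h v‖ := by
      refine norm_integral_le_of_norm_le hh.norm (.of_forall fun v => ?_)
      rw [norm_mul, Real.norm_of_nonneg (dilatedGaussian_pos ..).le]
      exact mul_le_of_le_one_right (norm_nonneg _) (dilatedGaussian_le_one a hbl.le ε v)
    have hp : b ε ^ (-(d : ℝ) / 2) ≤ s ^ (-(d : ℝ) / 2) :=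
      Real.rpow_le_rpow_of_nonpos hs (hb h0 h1) (by
        have : (0 : ℝ) ≤ d := d.cast_nonneg
        linarith)
    simp only [Q]
    rw [norm_mul, norm_mul, Real.norm_of_nonneg (by positivity),
      Real.norm_of_nonneg (by positivity), mul_assoc]
    gcongr
  have hlim : Tendsto (fun ε : ℝ => ε ^ σ * (s ^ (-(d : ℝ) / 2) * ∫ v, ‖h v‖)) (𝓝[>] 0) (𝓝 0) := by
    have h1 : Tendsto (fun ε : ℝ => ε ^ σ) (𝓝 0) (𝓝 0) := by
      simpa [Real.zero_rpow hσ.ne'] using (Real.continuousAt_rpow_const 0 σ (Or.inr hσ.le)).tendsto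
    simpa using (h1.mono_left nhdsWithin_le_nhds).mul_const (s ^ (-(d : ℝ) / 2) * ∫ v, ‖h v‖)
  have hQ1 : ‖Q 1‖ ≤ 0 := by
    refine ge_of_tendsto hlim ?_
    filter_upwards [Ioc_mem_nhdsGT (zero_lt_one' ℝ)] with ε hε
    rw [hconst hε.1 hε.2]
    exact hbound hε.1 hε.2
  have hz : Q 1 = 0 := norm_le_zero_iff.1 hQ1
  have e : Q 1 = s ^ (-(d : ℝ) / 2) * ∫ v, h v * Real.exp (-‖v - a‖ ^ 2 / (2 * s)) := by
    simp [Q, J, b, dilatedGaussian]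
  rw [e] at hz
  exact (mul_eq_zero.1 hz).resolve_left (Real.rpow_pos_of_pos hs _).ne'

/-! ### Gaussians separate integrable functions -/

/-- Identifies the rescaled kernels of the approximate identity as Maxwellians, to which the
orthogonality of `h` applies. -/
theorem pow_mul_maxwellian_one_smul {c : ℝ} (hc : 0 < c) (u : Vel d) :
    c ^ d * maxwellian d 1 (c • u) = maxwellian d (c ^ 2)⁻¹ u := by
  have e : ((c ^ 2)⁻¹ : ℝ) ^ (-(d : ℝ) / 2) = c ^ d := by
    rw [← Real.rpow_natCast c 2, ← Real.rpow_neg hc.le, ← Real.rpow_mul hc.le, ← Real.rpow_natCast]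
    congr 1
    push_cast
    ring
  unfold maxwellian
  rw [Real.mul_rpow (by positivity : 0 ≤ 2 * Real.pi) (inv_nonneg.2 (sq_nonneg c)), e,
    norm_smul, Real.norm_of_nonneg hc.le,
    mul_one]
  have e2 : -(c * ‖u‖) ^ 2 / (2 * 1) = -‖u‖ ^ 2 / (2 * (c ^ 2)⁻¹) := by
    field_simp
  rw [e2]
  ring

theorem tendsto_norm_pow_mul_maxwellian (d : ℕ) :
    Tendsto (fun u : Vel d => ‖u‖ ^ d * maxwellian d 1 u) (Bornology.cobounded (Vel d)) (𝓝 0) := by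
  have h1 : Tendsto (fun u : Vel d => ‖u‖ ^ 2) (Bornology.cobounded (Vel d)) atTop :=
    (tendsto_pow_atTop two_ne_zero).comp tendsto_norm_cobounded_atTop
  have h2 := ((tendsto_rpow_mul_exp_neg_mul_atTop_nhds_zero ((d : ℝ) / 2) (1 / 2)
    (by norm_num)).comp h1).const_mul ((2 * Real.pi * 1) ^ (-(d : ℝ) / 2))
  rw [mul_zero] at h2
  refine h2.congr fun u => ?_
  have e : (‖u‖ ^ 2) ^ ((d : ℝ) / 2) = ‖u‖ ^ d := by
    rw [← Real.rpow_natCast ‖u‖ 2, ← Real.rpow_mul (norm_nonneg u), ← Real.rpow_natCast]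
    congr 1
    push_cast
    ring
  have e2 : -(1 / 2) * ‖u‖ ^ 2 = -‖u‖ ^ 2 / (2 * 1) := by ring
  simp only [Function.comp_apply, maxwellian, e, e2]
  ring

/-- An integrable function orthogonal to all Gaussians vanishes almost everywhere. -/
theorem ae_eq_zero_of_integral_mul_exp_eq_zero (hh : Integrable h)
    (hz : ∀ s > 0, ∀ a : Vel d, ∫ v, h v * Real.exp (-‖v - a‖ ^ 2 / (2 * s)) = 0) :
    h =ᵐ[volume] 0 := by
  refine ae_eq_zero_of_integral_contDiff_smul_eq_zero hh.locallyIntegrable fun φ hφ hc => ?_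
  have hφi : Integrable φ := hφ.continuous.integrable_of_hasCompactSupport hc
  obtain ⟨C, hC⟩ := hc.exists_bound_of_continuous hφ.continuous
  -- `G c` is `φ` smoothed by the Maxwellian of temperature `c⁻²`. As `c → ∞` it converges pointwise
  -- to `φ` while staying below the bound `C` on `φ`.
  let G : ℝ → Vel d → ℝ := fun c v => ∫ w, c ^ d * maxwellian d 1 (c • (v - w)) * φ w
  have hG (v : Vel d) : Tendsto (fun c => G c v) atTop (𝓝 (φ v)) := by
    have := tendsto_integral_comp_smul_smul_of_integrable' (μ := (volume : Measure (Vel d)))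
      (φ := maxwellian d 1) (maxwellian_nonneg d zero_le_one) (integral_maxwellian d one_pos)
      (by simpa using tendsto_norm_pow_mul_maxwellian d) hφi (hφ.continuous.continuousAt (x := v))
    simpa using this
  have hGb {c : ℝ} (hc0 : 0 < c) (v : Vel d) : ‖G c v‖ ≤ C := by
    have hT : 0 < (c ^ 2)⁻¹ := by positivity
    have hi : Integrable fun w => maxwellian d (c ^ 2)⁻¹ (v - w) * C :=
      ((integrable_maxwellian d hT).comp_sub_left v).mul_const C
    have hle := norm_integral_le_of_norm_le (μ := volume)
      (f := fun w => c ^ d * maxwellian d 1 (c • (v - w)) * φ w) hi (.of_forall fun w => by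
        rw [pow_mul_maxwellian_one_smul hc0, norm_mul,
          Real.norm_of_nonneg (maxwellian_nonneg d hT.le _)]
        exact mul_le_mul_of_nonneg_left (hC w) (maxwellian_nonneg d hT.le _))
    rwa [integral_mul_const, integral_sub_left_eq_self (fun u => maxwellian d (c ^ 2)⁻¹ u) volume v,
      integral_maxwellian d hT, one_mul] at hle
  have hmeas (c : ℝ) : Continuous fun p : Vel d × Vel d =>
      c ^ d * maxwellian d 1 (c • (p.1 - p.2)) := by
    have := continuous_maxwellian d 1
    fun_prop
  have hprod {c : ℝ} (hc0 : 0 < c) : Integrable (fun p : Vel d × Vel d =>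
      c ^ d * maxwellian d 1 (c • (p.1 - p.2)) * (h p.1 * φ p.2)) (volume.prod volume) := by
    refine (hh.mul_prod hφi).bdd_mul (c := c ^ d * (2 * Real.pi * 1) ^ (-(d : ℝ) / 2))
      (hmeas c).aestronglyMeasurable (.of_forall fun p => ?_)
    rw [Real.norm_of_nonneg (mul_nonneg (by positivity) (maxwellian_nonneg d zero_le_one _))]
    refine mul_le_mul_of_nonneg_left ?_ (by positivity)
    refine mul_le_of_le_one_right (by positivity) (Real.exp_le_one_iff.2 ?_)
    exact div_nonpos_of_nonpos_of_nonneg (by simp) (by norm_num)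
  -- After Fubini, the inner integral at each `w` pairs `h` with a Gaussian centred at `w`.
  have hzero {c : ℝ} (hc0 : 0 < c) : ∫ v, h v * G c v = 0 := by
    have e1 (v : Vel d) : h v * G c v =
        ∫ w, c ^ d * maxwellian d 1 (c • (v - w)) * (h v * φ w) := by
      simp only [G]
      rw [← integral_const_mul]
      congr 1 with w
      ring
    simp only [e1]
    rw [integral_integral_swap (hprod hc0)]
    refine integral_eq_zero_of_ae (.of_forall fun w => ?_)
    have e2 (v : Vel d) : c ^ d * maxwellian d 1 (c • (v - w)) * (h v * φ w) =
        (2 * Real.pi * (c ^ 2)⁻¹) ^ (-(d : ℝ) / 2) * φ w *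
          (h v * Real.exp (-‖v - w‖ ^ 2 / (2 * (c ^ 2)⁻¹))) := by
      rw [pow_mul_maxwellian_one_smul hc0, maxwellian]
      ring
    simp only [e2]
    rw [integral_const_mul, hz _ (by positivity), mul_zero, Pi.zero_apply]
  have hlim : Tendsto (fun c => ∫ v, h v * G c v) atTop (𝓝 (∫ v, h v * φ v)) := by
    refine tendsto_integral_filter_of_dominated_convergence (fun v => ‖h v‖ * C) ?_ ?_
      (hh.norm.mul_const C) (.of_forall fun v => (hG v).const_mul (h v))
    · refine .of_forall fun c => hh.aestronglyMeasurable.mul ?_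
      refine AEStronglyMeasurable.integral_prod_right' (f := fun p : Vel d × Vel d =>
        c ^ d * maxwellian d 1 (c • (p.1 - p.2)) * φ p.2) ?_
      exact ((hmeas c).mul (hφ.continuous.comp continuous_snd)).aestronglyMeasurable
    · filter_upwards [eventually_gt_atTop 0] with c hc0
      refine .of_forall fun v => ?_
      rw [norm_mul]
      exact mul_le_mul_of_nonneg_left (hGb hc0 v) (norm_nonneg _)
  have h0 : ∫ v, h v * φ v = 0 := by
    refine tendsto_nhds_unique hlim (tendsto_const_nhds.congr' ?_)
    filter_upwards [eventually_gt_atTop 0] with c hc0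
    exact (hzero hc0).symm
  simpa only [smul_eq_mul, mul_comm] using h0

/-! ### Uniqueness of weak steady states -/

/-- The gain part of a reservoir depends on the state only through its mass, so it cancels in the
difference. Only the losses, of total rate `totalRate η`, remain. -/
theorem IsWeakSteadyState.isWeakKernel_sub {k : ℕ} {η T : Fin k → ℝ} {f g : Vel d → ℝ}
    (hf : IsWeakSteadyState η T f) (hg : IsWeakSteadyState η T g)
    (hfg : ∫ v, f v = ∫ v, g v) :
    IsWeakKernel (limitTemp η T) (totalRate η) fun v => f v - g v := by
  intro φ hφ hc
  obtain ⟨hfi, hf'⟩ := hf 1 one_pos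
  obtain ⟨hgi, hg'⟩ := hg 1 one_pos
  have hf0 := (hf' φ hφ hc).unique (hasDerivAt_const 1 (∫ v, f v * φ v))
  have hg0 := (hg' φ hφ hc).unique (hasDerivAt_const 1 (∫ v, g v * φ v))
  have hφ1 : ContDiff ℝ 1 φ := contDiff_infty.1 hφ 1
  have hψc : Continuous fun v => limitTemp η T * laplacian φ v - fderiv ℝ φ v v :=
    (continuous_const.mul (continuous_laplacian (contDiff_infty.1 hφ 2))).sub
      ((hφ1.continuous_fderiv one_ne_zero).clm_apply continuous_id)
  have hψs : HasCompactSupport fun v => limitTemp η T * laplacian φ v - fderiv ℝ φ v v := by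
    refine hc.mono' fun v hv => ?_
    contrapose! hv
    have h0 : φ =ᶠ[𝓝 v] fun _ => 0 := notMem_tsupport_iff_eventuallyEq.1 hv
    simp [(laplacian_congr_nhds h0).eq_of_nhds, fderiv_of_notMem_tsupport ℝ hv]
  obtain ⟨C, hC⟩ := hψs.exists_bound_of_continuous hψc
  obtain ⟨D, hD⟩ := hc.exists_bound_of_continuous hφ.continuous
  have hψi {u : Vel d → ℝ} (hu : Integrable u) :
      Integrable fun v => u v * (limitTemp η T * laplacian φ v - fderiv ℝ φ v v) :=
    hu.mul_bdd hψc.aestronglyMeasurable (.of_forall hC)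
  have hφi {u : Vel d → ℝ} (hu : Integrable u) : Integrable fun v => u v * φ v :=
    hu.mul_bdd hφ.continuous.aestronglyMeasurable (.of_forall hD)
  have hMi (j : Fin k) : Integrable fun v => maxwellian d (T j) v * φ v :=
    ((continuous_maxwellian d (T j)).mul hφ.continuous).integrable_of_hasCompactSupport hc.mul_left
  have hres {u : Vel d → ℝ} (hu : Integrable u) (j : Fin k) :
      ∫ v, reservoir (η j) (T j) u v * φ v =
        η j * (∫ v, u v) * (∫ v, maxwellian d (T j) v * φ v) - η j * ∫ v, u v * φ v := by
    rw [← integral_const_mul (η j * ∫ v, u v), ← integral_const_mul (η j) fun v => u v * φ v,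
      ← integral_sub ((hMi j).const_mul _) ((hφi hu).const_mul _)]
    congr 1 with v
    simp only [reservoir]
    ring
  simp only [hres hfi, hres hgi, Finset.sum_sub_distrib, ← Finset.sum_mul, hfg] at hf0 hg0
  have e : ∫ v, (f v - g v) *
      (limitTemp η T * laplacian φ v - fderiv ℝ φ v v - totalRate η * φ v) =
      ((∫ v, f v * (limitTemp η T * laplacian φ v - fderiv ℝ φ v v)) -
        ∫ v, g v * (limitTemp η T * laplacian φ v - fderiv ℝ φ v v)) -
      (totalRate η * (∫ v, f v * φ v) - totalRate η * ∫ v, g v * φ v) := by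
    have i1 := (hψi hfi).sub (hψi hgi)
    have i2 := ((hφi hfi).const_mul (totalRate η)).sub ((hφi hgi).const_mul (totalRate η))
    simp only [Pi.sub_def] at i1 i2
    rw [← integral_sub (hψi hfi) (hψi hgi), ← integral_const_mul, ← integral_const_mul,
      ← integral_sub ((hφi hfi).const_mul _) ((hφi hgi).const_mul _), ← integral_sub i1 i2]
    congr 1 with v
    ring
  rw [e, totalRate]
  linear_combination hf0 - hg0

theorem IsWeakSteadyState.ae_eq {k : ℕ} {η T : Fin k → ℝ} {f g : Vel d → ℝ}
    (hf : IsWeakSteadyState η T f) (hg : IsWeakSteadyState η T g)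
    (hfg : ∫ v, f v = ∫ v, g v) (hτ : 0 ≤ limitTemp η T) (hσ : 0 < totalRate η) :
    f =ᵐ[volume] g := by
  have hi : Integrable fun v => f v - g v := (hf 1 one_pos).1.sub (hg 1 one_pos).1
  have hz := ae_eq_zero_of_integral_mul_exp_eq_zero hi fun s hs a =>
    (hf.isWeakKernel_sub hg hfg).integral_mul_exp_eq_zero hi hτ hσ hs a
  filter_upwards [hz] with v hv
  exact sub_eq_zero.1 hv

end Thermostat

end

theorem theorem3 (d : ℕ) (η T : Fin 2 → ℝ) (hη : ∀ j, 0 < η j) (hT₀ : 0 < T 0) (hT : T 0 < T 1) :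
    -- the weight is a probability density on `[T_1, T_2]`
    ((∀ s, 0 ≤ Thermostat.weight η T s) ∧
      IntegrableOn (Thermostat.weight η T) (Set.Icc (T 0) (T 1)) ∧
      ∫ s in Set.Icc (T 0) (T 1), Thermostat.weight η T s = 1) ∧
    -- the mixture is a smooth probability density and a steady state, classically and weakly
    ((∀ v, 0 ≤ Thermostat.mixture d η T v) ∧
      Integrable (Thermostat.mixture d η T) ∧
      ∫ v, Thermostat.mixture d η T v = 1 ∧
      ContDiff ℝ ∞ (Thermostat.mixture d η T) ∧
      Thermostat.IsClassicalSteadyState η T (Thermostat.mixture d η T) ∧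
      Thermostat.IsWeakSteadyState η T (Thermostat.mixture d η T)) ∧
    -- uniqueness among all normalized classical steady states
    (∀ g : Thermostat.Vel d → ℝ, ∫ v, g v = 1 →
      Thermostat.IsClassicalSteadyState η T g → g = Thermostat.mixture d η T) ∧
    -- uniqueness among all normalized weak steady states
    (∀ g : Thermostat.Vel d → ℝ, ∫ v, g v = 1 →
      Thermostat.IsWeakSteadyState η T g → g =ᵐ[volume] Thermostat.mixture d η T) := by
  have hcl := Thermostat.isClassicalSteadyState_mixture (d := d) hη hT₀ hT
  have hsm := Thermostat.contDiff_mixture (d := d) hη hT₀ hT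
  have hint := Thermostat.integral_mixture (d := d) hη hT₀ hT
  have hweak (g : Thermostat.Vel d → ℝ) (hg : ∫ v, g v = 1)
      (hs : Thermostat.IsWeakSteadyState η T g) : g =ᵐ[volume] Thermostat.mixture d η T :=
    hs.ae_eq hcl.isWeakSteadyState (hg.trans hint.symm)
      (hT₀.trans (Thermostat.lt_limitTemp hη hT)).le (Thermostat.totalRate_pos hη)
  refine ⟨⟨Thermostat.weight_nonneg hη hT, Thermostat.integrableOn_weight hη hT,
    Thermostat.integral_weight hη hT⟩, ⟨Thermostat.mixture_nonneg hη hT₀ hT,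
    Thermostat.integrable_mixture hη hT₀ hT, hint, hsm, hcl, hcl.isWeakSteadyState⟩, ?_, hweak⟩
  intro g hg hs
  -- Lebesgue measure charges every nonempty open set, so continuous functions equal almost
  -- everywhere are equal.
  exact Continuous.ae_eq_iff_eq volume (hs 1 one_pos).2.1.continuous hsm.continuous |>.1
    (hweak g hg hs.isWeakSteadyState)
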